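/- Let $p\ge 1$ be an integer and $T>0$. For $N\ge 1$ consider the uniform mesh $t_i=ih$, $i=0,\dots,N$, $h=T/N$, of $[0,T]$. Let $S_h^{p,0}(0,T)$ be the space of functions that are continuous on $[0,T]$ and polynomials of degree at most $p$ on every mesh element, and let $S_h^{p-1,-1}(0,T)$ be the space of (possibly discontinuous) functions that are polynomials of degree at most $p-1$ on every mesh element. Point values and classical derivatives of a Sobolev function on $(0,T)$ are those of its continuous representative on $[0,T]$. For every $N\ge1$, the projection operator $\mathcal P_h^p:H^1(0,T)\to S_h^{p,0}(0,T)$ defined by $$\mathcal P_h^p v(0)=v(0),\qquad \int_0^T \mathcal P_h^p v(t)\,e^{-t/T}q(t)\,dt=\int_0^T v(t)\,e^{-t/T}q(t)\,dt\quad\text{for all } q\in S_h^{p-1,-1}(0,T)$$ is well defined: for every $v\in H^1(0,T)$ exactly one function in $S_h^{p,0}(0,T)$ satisfies these conditions; moreover $S_h^{p,0}(0,T)\subset H^1(0,T)$ and $\mathcal P_h^p w=w$ for all $w\in S_h^{p,0}(0,T)$. Furthermore, there is a constant $C>0$ depending only on $p$ and $T$ such that, for every $N\ge 1$ and every $v\in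 W^{p+2}_\infty(0,T)$ whose classical derivative $\partial_t^{p+2}v(t)$ exists at every $t\in(0,T)$, $$\max_{i=1,\dots,N}|v(t_i)-\mathcal P_h^p v(t_i)|\le C\,h^{p+(p \bmod 2)}\Bigl(\|\partial_t^{p+1}v\|_{L^\infty(0,T)}+\|\partial_t^{p+2}v\|_{L^\infty(0,T)}\Bigr).$$ -/

import Mathlib

open MeasureTheory Set
open scoped ContDiff

/-- Lebesgue measure on the open interval `(0, T)`. -/
noncomputable def volT (T : ℝ) : Measure ℝ := volume.restrict (Ioo 0 T)

/-- `g` is the weak derivative of `f` on `(0, T)`: integration by parts against every smooth test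
function with compact support in `(0, T)`. -/
def HasWeakDeriv (T : ℝ) (f g : ℝ → ℝ) : Prop :=
  LocallyIntegrableOn f (Ioo 0 T) ∧ LocallyIntegrableOn g (Ioo 0 T) ∧
    ∀ φ : ℝ → ℝ, ContDiff ℝ ∞ φ → HasCompactSupport φ → tsupport φ ⊆ Ioo 0 T →
      ∫ t, f t * deriv φ t ∂(volT T) = -∫ t, g t * φ t ∂(volT T)

/-- `v` represents an element of the Sobolev space `H¹(0, T)`. -/
def MemH1 (T : ℝ) (v : ℝ → ℝ) : Prop :=
  MemLp v 2 (volT T) ∧ ∃ g : ℝ → ℝ, MemLp g 2 (volT T) ∧ HasWeakDeriv T v g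

/-- `v` represents an element of the Sobolev space `W_∞^k(0, T)`: the weak derivatives of order
`0, …, k` exist and are essentially bounded (`g j` is the one of order `j`). -/
def MemWInf (T : ℝ) (k : ℕ) (v : ℝ → ℝ) : Prop :=
  ∃ g : ℕ → ℝ → ℝ, g 0 = v ∧ (∀ j ≤ k, MemLp (g j) (⊤ : ENNReal) (volT T)) ∧
    ∀ j < k, HasWeakDeriv T (g j) (g (j + 1))

/-- `c` is the representative of `v` that is continuous on `[0, T]`; only its values on `[0, T]`
matter, and there they are unique. Point values of a Sobolev function are the values of `c`. -/
def IsContRep (T : ℝ) (v c : ℝ → ℝ) : Prop :=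
  ContinuousOn c (Icc 0 T) ∧ v =ᵐ[volT T] c

/-- The functions in `W_∞^k(0, T)` whose classical derivative of order `k` exists at every point of
`(0, T)`. -/
def MemWInfTilde (T : ℝ) (k : ℕ) (v : ℝ → ℝ) : Prop :=
  MemWInf T k v ∧ ∃ c : ℝ → ℝ, IsContRep T v c ∧
    ∀ j < k, ∀ t ∈ Ioo 0 T, DifferentiableAt ℝ (iteratedDeriv j c) t

/-- The `L^∞(0, T)` norm (of an essentially bounded function). -/
noncomputable def normLInf (T : ℝ) (f : ℝ → ℝ) : ℝ :=
  (eLpNorm f (⊤ : ENNReal) (volT T)).toReal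

/-- The nodes `t_i = i h`, `h = T / N`, of the uniform mesh with `N` elements on `[0, T]`. -/
noncomputable def meshNode (T : ℝ) (N i : ℕ) : ℝ := i * (T / N)

/-- The space `S_h^{k,-1}(0, T)` of discontinuous piecewise polynomials of degree (at most) `k`;
values at the nodes are irrelevant. -/
def DiscPoly (T : ℝ) (N k : ℕ) : Set (ℝ → ℝ) :=
  {q | ∀ i < N, ∃ r : Polynomial ℝ, r.natDegree ≤ k ∧
    ∀ t ∈ Ioo (meshNode T N i) (meshNode T N (i + 1)), q t = r.eval t}

/-- The space `S_h^{k,0}(0, T)` of continuous piecewise polynomials of degree (at most) `k`. -/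
def ContPoly (T : ℝ) (N k : ℕ) : Set (ℝ → ℝ) :=
  {w | ContinuousOn w (Icc 0 T) ∧ w ∈ DiscPoly T N k}

/-- `w = 𝒫_h^p v`: the function `w` belongs to `S_h^{p,0}(0, T)`, satisfies `w(0) = v(0)`, and
`(w, e^{-•/T} q) = (v, e^{-•/T} q)` in `L²(0, T)` for all `q ∈ S_h^{p-1,-1}(0, T)`. -/
structure IsProj (T : ℝ) (N p : ℕ) (v w : ℝ → ℝ) : Prop where
  mem : w ∈ ContPoly T N p
  init : ∃ c : ℝ → ℝ, IsContRep T v c ∧ w 0 = c 0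
  orth : ∀ q ∈ DiscPoly T N (p - 1),
    ∫ t, w t * (Real.exp (-t / T) * q t) ∂(volT T) =
      ∫ t, v t * (Real.exp (-t / T) * q t) ∂(volT T)

/-!
The weight makes the problem local. On the `i`-th element it is a constant times
`e^{-(t - t_i) / T}`, so after rescaling to `[0, 1]` every element carries the same local problem
`IsLocalProj` with weight `e^{-θ x}`, `θ = 1 / N ∈ (0, 1]`: a polynomial of degree at most `p` with a
prescribed value at `0`, orthogonality being tested with degree less than `p`. If a solution of the
homogeneous problem vanishes at `0`, it is `x r(x)`, and testing with `r` gives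
`∫ x e^{-θ x} r² = 0`; hence the local problem is uniquely solvable, with a stability constant
uniform in `θ` by equivalence of norms. Gluing the local solutions from left to right gives existence
and uniqueness of the projection (`orth_iff_local`, `exists_isProj`, `IsProj.unique`). The value
`v(0)` makes sense since a function with an integrable weak derivative is a.e. a primitive of it
(`HasWeakDeriv.exists_isContRep`), and `S_h^{p,0} ⊂ H¹` by integration by parts off the nodes
(`ContPoly.memH1`).

For the estimate, expand `v` at the left node of an element up to order `p + 1`. The local projection
reproduces the part of degree `p`, so the nodal errors `e_i = v(t_i) - w(t_i)` satisfy
`e_{i+1} = R e_i + κ v^{(p+1)}(t_i) + O(h^{p+2})` with `κ = O(h^{p+1})` independent of `i`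
(`abs_error_sub_recursion_le`). Here `R = z(1)` for the polynomial `z` of degree `p` with `z(0) = 1`
that is orthogonal to lower degrees. Testing with `z'` gives
`z(1)² e^{-θ} - 1 = -θ ∫ z² e^{-θ x} ≤ 0`, so `|R|^N ≤ e^{1 / 2}` (`IsLocalProj.eval_one_sq_le`).
Summing `N = T / h` contributions of size `h^{p+1}` gives `h^p`. For odd `p` the `p` zeros of `z` lie
in `(0, 1)`, so `R < 0` (`IsLocalProj.eval_one_neg`), and the contributions of neighbouring elements
cancel up to the increments of `v^{(p+1)}`, which are `O(h)` (`abs_le_of_recursion_of_nonpos`); this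
gives `h^{p+1}`.
-/

/-! ### Local projections on the reference element -/

/-- `P` is the local projection of `f` on the reference element `[0, 1]` with initial value `a`: the
polynomial of degree at most `p` with `P(0) = a` such that `P - f` is orthogonal, with respect to
the weight `e^{-θ x}`, to all polynomials of degree less than `p`. The initial value is a separate
parameter because the global projection passes on its own value at a node, not that of `f`. -/
structure IsLocalProj (θ : ℝ) (p : ℕ) (a : ℝ) (f : ℝ → ℝ) (P : Polynomial ℝ) : Prop where
  mem : P ∈ Polynomial.degreeLT ℝ (p + 1)
  init : P.eval 0 = a
  orth : ∀ q ∈ Polynomial.degreeLT ℝ p,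
    ∫ x in (0 : ℝ)..1, P.eval x * (Real.exp (-(θ * x)) * q.eval x) =
      ∫ x in (0 : ℝ)..1, f x * (Real.exp (-(θ * x)) * q.eval x)

theorem integral_exp_mul_eval_pos (θ : ℝ) {F : Polynomial ℝ} (hF : F ≠ 0)
    (h0 : ∀ x ∈ Icc (0 : ℝ) 1, 0 ≤ F.eval x) :
    0 < ∫ x in (0 : ℝ)..1, Real.exp (-(θ * x)) * F.eval x := by
  have hc : Continuous fun x : ℝ => Real.exp (-(θ * x)) * F.eval x := by fun_prop
  refine intervalIntegral.integral_pos zero_lt_one hc.continuousOn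
    (fun x hx => mul_nonneg (Real.exp_pos _).le (h0 x ⟨hx.1.le, hx.2⟩)) ?_
  by_contra! hcon
  refine hF (Polynomial.eq_zero_of_infinite_isRoot F
    ((Icc_infinite (zero_lt_one' ℝ)).mono fun x hx => ?_))
  have h1 := hcon x hx
  have h2 := h0 x hx
  have h3 : F.eval x ≤ 0 := by
    by_contra! h
    exact absurd (mul_pos (Real.exp_pos (-(θ * x))) h) (not_lt.2 h1)
  exact le_antisymm h3 h2

/-- The uniqueness principle for local projections: if `X * r` is orthogonal to `r`, then
`∫ x e^{-θ x} r(x)² = 0`, so `r = 0`. -/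
theorem X_mul_eq_zero_of_orth (θ : ℝ) {r : Polynomial ℝ}
    (h : ∫ x in (0 : ℝ)..1, (Polynomial.X * r).eval x * (Real.exp (-(θ * x)) * r.eval x) = 0) :
    r = 0 := by
  by_contra hr
  have h1 := integral_exp_mul_eval_pos θ (F := Polynomial.X * r * r)
    (mul_ne_zero (mul_ne_zero Polynomial.X_ne_zero hr) hr) (fun x hx => by
      simp only [Polynomial.eval_mul, Polynomial.eval_X, mul_assoc]
      exact mul_nonneg hx.1 (mul_self_nonneg _))
  refine absurd h ?_
  refine ne_of_gt (h1.trans_eq ?_)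
  refine intervalIntegral.integral_congr fun x _ => ?_
  simp only [Polynomial.eval_mul, Polynomial.eval_X]
  ring

theorem exists_eq_X_mul_of_eval_zero {p : ℕ} {Q : Polynomial ℝ}
    (hQ : Q ∈ Polynomial.degreeLT ℝ (p + 1)) (h0 : Q.eval 0 = 0) :
    ∃ r ∈ Polynomial.degreeLT ℝ p, Q = Polynomial.X * r := by
  obtain ⟨r, rfl⟩ : Polynomial.X ∣ Q := by
    rw [Polynomial.X_dvd_iff, Polynomial.coeff_zero_eq_eval_zero, h0]
  refine ⟨r, ?_, rfl⟩
  rw [Polynomial.mem_degreeLT] at hQ ⊢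
  by_cases hr : r = 0
  · simp only [hr, Polynomial.degree_zero]
    exact WithBot.bot_lt_coe p
  · rw [Polynomial.degree_mul, Polynomial.degree_X, Polynomial.degree_eq_natDegree hr] at hQ
    rw [Polynomial.degree_eq_natDegree hr]
    norm_cast at hQ ⊢
    omega

theorem X_mul_mem_degreeLT {p : ℕ} {r : Polynomial ℝ} (hr : r ∈ Polynomial.degreeLT ℝ p) :
    Polynomial.X * r ∈ Polynomial.degreeLT ℝ (p + 1) := by
  rw [Polynomial.mem_degreeLT] at hr ⊢
  by_cases h0 : r = 0
  · simp only [h0, mul_zero, Polynomial.degree_zero]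
    exact WithBot.bot_lt_coe _
  · rw [Polynomial.degree_eq_natDegree h0] at hr
    rw [Polynomial.degree_mul, Polynomial.degree_X, Polynomial.degree_eq_natDegree h0]
    norm_cast at hr ⊢
    omega

theorem intervalIntegrable_mul_exp_mul_eval (θ : ℝ) {f : ℝ → ℝ} (hf : ContinuousOn f (Icc 0 1))
    (q : Polynomial ℝ) :
    IntervalIntegrable (fun x => f x * (Real.exp (-(θ * x)) * q.eval x)) volume 0 1 := by
  refine ContinuousOn.intervalIntegrable ?_
  rw [uIcc_of_le zero_le_one]
  exact hf.mul (by fun_prop)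

theorem intervalIntegrable_eval_mul_exp_mul_eval (θ : ℝ) (P q : Polynomial ℝ) :
    IntervalIntegrable (fun x => P.eval x * (Real.exp (-(θ * x)) * q.eval x)) volume 0 1 :=
  intervalIntegrable_mul_exp_mul_eval θ P.continuousOn q

namespace IsLocalProj

theorem self {θ : ℝ} {p : ℕ} {P : Polynomial ℝ} (hP : P ∈ Polynomial.degreeLT ℝ (p + 1)) :
    IsLocalProj θ p (P.eval 0) (fun x => P.eval x) P :=
  ⟨hP, rfl, fun _ _ => rfl⟩

theorem add {θ : ℝ} {p : ℕ} {a b : ℝ} {f g : ℝ → ℝ} {P Q : Polynomial ℝ}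
    (hf : ContinuousOn f (Icc 0 1)) (hg : ContinuousOn g (Icc 0 1))
    (hP : IsLocalProj θ p a f P) (hQ : IsLocalProj θ p b g Q) :
    IsLocalProj θ p (a + b) (fun x => f x + g x) (P + Q) := by
  refine ⟨Submodule.add_mem _ hP.mem hQ.mem, by simp [hP.init, hQ.init], fun q hq => ?_⟩
  simp only [Polynomial.eval_add, add_mul]
  rw [intervalIntegral.integral_add (intervalIntegrable_eval_mul_exp_mul_eval θ P q)
    (intervalIntegrable_eval_mul_exp_mul_eval θ Q q),
    intervalIntegral.integral_add (intervalIntegrable_mul_exp_mul_eval θ hf q)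
    (intervalIntegrable_mul_exp_mul_eval θ hg q), hP.orth q hq, hQ.orth q hq]

theorem smul {θ : ℝ} {p : ℕ} {a : ℝ} {f : ℝ → ℝ} {P : Polynomial ℝ} (k : ℝ)
    (hP : IsLocalProj θ p a f P) :
    IsLocalProj θ p (k * a) (fun x => k * f x) (Polynomial.C k * P) := by
  refine ⟨?_, by simp [hP.init], fun q hq => ?_⟩
  · rw [← Polynomial.smul_eq_C_mul]
    exact Submodule.smul_mem _ _ hP.mem
  simp only [Polynomial.eval_mul, Polynomial.eval_C, mul_assoc]
  rw [intervalIntegral.integral_const_mul, intervalIntegral.integral_const_mul, hP.orth q hq]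

theorem unique {θ : ℝ} {p : ℕ} {a : ℝ} {f : ℝ → ℝ} {P Q : Polynomial ℝ}
    (hP : IsLocalProj θ p a f P) (hQ : IsLocalProj θ p a f Q) : P = Q := by
  obtain ⟨r, hr, hPQ⟩ := exists_eq_X_mul_of_eval_zero (Q := P - Q)
    (Submodule.sub_mem _ hP.mem hQ.mem) (by simp [hP.init, hQ.init])
  have h : r = 0 := by
    refine X_mul_eq_zero_of_orth θ ?_
    rw [← hPQ]
    simp only [Polynomial.eval_sub, sub_mul]
    rw [intervalIntegral.integral_sub (intervalIntegrable_eval_mul_exp_mul_eval θ P r)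
      (intervalIntegrable_eval_mul_exp_mul_eval θ Q r), hP.orth r hr, hQ.orth r hr, sub_self]
  rw [h, mul_zero] at hPQ
  exact sub_eq_zero.1 hPQ

theorem congr {θ : ℝ} {p : ℕ} {a : ℝ} {f g : ℝ → ℝ} {P : Polynomial ℝ}
    (hP : IsLocalProj θ p a f P) (hfg : EqOn f g (Icc 0 1)) : IsLocalProj θ p a g P := by
  refine ⟨hP.mem, hP.init, fun q hq => (hP.orth q hq).trans ?_⟩
  refine intervalIntegral.integral_congr fun x hx => ?_
  rw [uIcc_of_le zero_le_one] at hx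
  simp only [hfg hx]

end IsLocalProj

/-- The weighted bilinear form `(r, q) ↦ ∫ x e^{-θ x} r(x) q(x)` on polynomials of degree less
than `p`. -/
noncomputable def weightedForm (θ : ℝ) (p : ℕ) :
    Polynomial.degreeLT ℝ p →ₗ[ℝ] Polynomial.degreeLT ℝ p →ₗ[ℝ] ℝ :=
  LinearMap.mk₂ ℝ (fun r q => ∫ x in (0 : ℝ)..1,
      (Polynomial.X * r.1).eval x * (Real.exp (-(θ * x)) * q.1.eval x))
    (fun r₁ r₂ q => by
      rw [← intervalIntegral.integral_add (intervalIntegrable_eval_mul_exp_mul_eval θ _ _)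
        (intervalIntegrable_eval_mul_exp_mul_eval θ _ _)]
      refine intervalIntegral.integral_congr fun x _ => ?_
      simp
      ring)
    (fun k r q => by
      rw [smul_eq_mul, ← intervalIntegral.integral_const_mul]
      refine intervalIntegral.integral_congr fun x _ => ?_
      simp
      ring)
    (fun r q₁ q₂ => by
      rw [← intervalIntegral.integral_add (intervalIntegrable_eval_mul_exp_mul_eval θ _ _)
        (intervalIntegrable_eval_mul_exp_mul_eval θ _ _)]
      refine intervalIntegral.integral_congr fun x _ => ?_
      simp
      ring)
    (fun k r q => by
      rw [smul_eq_mul, ← intervalIntegral.integral_const_mul]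
      refine intervalIntegral.integral_congr fun x _ => ?_
      simp
      ring)

theorem weightedForm_surjective (θ : ℝ) (p : ℕ) : Function.Surjective (weightedForm θ p) := by
  have : Module.Finite ℝ (Polynomial.degreeLT ℝ p) :=
    Module.Finite.equiv (Polynomial.degreeLTEquiv ℝ p).symm
  refine (LinearMap.injective_iff_surjective_of_finrank_eq_finrank ?_).1 ?_
  · exact (Subspace.dual_finrank_eq (K := ℝ) (V := Polynomial.degreeLT ℝ p)).symm
  · rw [← LinearMap.ker_eq_bot, LinearMap.ker_eq_bot']
    intro r hr
    exact Subtype.ext (X_mul_eq_zero_of_orth θ (LinearMap.congr_fun hr r))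

theorem IsLocalProj.exists (θ : ℝ) (p : ℕ) (a : ℝ) {f : ℝ → ℝ} (hf : ContinuousOn f (Icc 0 1)) :
    ∃ P, IsLocalProj θ p a f P := by
  have hfa : ContinuousOn (fun x => f x - a) (Icc 0 1) := hf.sub continuousOn_const
  let l : Polynomial.degreeLT ℝ p →ₗ[ℝ] ℝ :=
    { toFun := fun q => ∫ x in (0 : ℝ)..1, (f x - a) * (Real.exp (-(θ * x)) * q.1.eval x)
      map_add' := fun q₁ q₂ => by
        rw [← intervalIntegral.integral_add (intervalIntegrable_mul_exp_mul_eval θ hfa _)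
          (intervalIntegrable_mul_exp_mul_eval θ hfa _)]
        refine intervalIntegral.integral_congr fun x _ => ?_
        simp
        ring
      map_smul' := fun k q => by
        rw [RingHom.id_apply, smul_eq_mul, ← intervalIntegral.integral_const_mul]
        refine intervalIntegral.integral_congr fun x _ => ?_
        simp
        ring }
  obtain ⟨r, hr⟩ := weightedForm_surjective θ p l
  have h0 : IsLocalProj θ p 0 (fun x => f x - a) (Polynomial.X * r.1) :=
    ⟨X_mul_mem_degreeLT r.2, by simp, fun q hq => LinearMap.congr_fun hr ⟨q, hq⟩⟩
  have ha : IsLocalProj θ p a (fun _ => a) (Polynomial.C a) := by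
    have := IsLocalProj.self (θ := θ) (p := p) (P := Polynomial.C a) (by
      rw [Polynomial.mem_degreeLT]
      exact Polynomial.degree_C_le.trans_lt (by exact_mod_cast Nat.succ_pos p))
    simpa using this
  have hsum := h0.add hfa continuousOn_const ha
  exact ⟨_, by simpa using hsum⟩

/-- Equivalence of norms on polynomials of degree less than `p`, in the form used for stability:
the weighted `L²` norm controls the values on `[0, 1]`. -/
theorem exists_eval_sq_le_integral (p : ℕ) :
    ∃ K : ℝ, 0 < K ∧ ∀ r ∈ Polynomial.degreeLT ℝ p, ∀ y ∈ Icc (0 : ℝ) 1,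
      (r.eval y) ^ 2 ≤ K * ∫ x in (0 : ℝ)..1, x * (r.eval x) ^ 2 := by
  let Φ : (Fin p → ℝ) → ℝ := fun a => ∫ x in (0 : ℝ)..1, x * (∑ i, a i * x ^ (i : ℕ)) ^ 2
  have hΦc : Continuous Φ := by
    refine intervalIntegral.continuous_parametric_intervalIntegral_of_continuous' ?_ 0 1
    simp only [Function.uncurry_def]
    fun_prop
  have heval : ∀ r ∈ Polynomial.degreeLT ℝ p, ∀ x : ℝ,
      r.eval x = ∑ i : Fin p, r.coeff i * x ^ (i : ℕ) := by
    intro r hr x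
    exact Polynomial.eval_eq_sum_degreeLTEquiv hr x
  have hΦpos : ∀ a, a ≠ 0 → 0 < Φ a := by
    intro a ha
    let r : Polynomial.degreeLT ℝ p := (Polynomial.degreeLTEquiv ℝ p).symm a
    have hr : ∀ x : ℝ, r.1.eval x = ∑ i : Fin p, a i * x ^ (i : ℕ) := by
      intro x
      rw [Polynomial.eval_eq_sum_degreeLTEquiv r.2 x]
      refine Finset.sum_congr rfl fun i _ => ?_
      congr 1
      exact congrFun ((Polynomial.degreeLTEquiv ℝ p).apply_symm_apply a) i
    have hr0 : r.1 ≠ 0 := by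
      intro h
      apply ha
      have : r = 0 := Subtype.ext h
      simpa [r] using this
    have := integral_exp_mul_eval_pos 0 (F := Polynomial.X * r.1 ^ 2)
      (mul_ne_zero Polynomial.X_ne_zero (pow_ne_zero 2 hr0)) (fun x hx => by
        simp only [Polynomial.eval_mul, Polynomial.eval_X, Polynomial.eval_pow]
        exact mul_nonneg hx.1 (sq_nonneg _))
    simpa [Φ, hr] using this
  have hhom : ∀ (k : ℝ) a, Φ (k • a) = k ^ 2 * Φ a := by
    intro k a
    simp only [Φ]
    rw [← intervalIntegral.integral_const_mul]
    refine intervalIntegral.integral_congr fun x _ => ?_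
    simp only [Pi.smul_apply, smul_eq_mul, mul_assoc, ← Finset.mul_sum]
    ring
  obtain ⟨m, hm, hmle⟩ : ∃ m : ℝ, 0 < m ∧ ∀ a : Fin p → ℝ, m * ‖a‖ ^ 2 ≤ Φ a := by
    have hs : IsCompact (Metric.sphere (0 : Fin p → ℝ) 1) := isCompact_sphere _ _
    obtain ⟨m, hm, hmle⟩ := hs.exists_forall_le' hΦc.continuousOn (a := 0) (fun a ha =>
      hΦpos a (by rintro rfl; simp at ha))
    refine ⟨m, hm, fun a => ?_⟩
    by_cases ha : a = 0
    · simp [ha, Φ]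
    have hn : 0 < ‖a‖ := norm_pos_iff.2 ha
    have h1 := hmle (‖a‖⁻¹ • a) (by simp [norm_smul, hn.ne'])
    rw [hhom] at h1
    calc m * ‖a‖ ^ 2 ≤ (‖a‖⁻¹ ^ 2 * Φ a) * ‖a‖ ^ 2 := by gcongr
      _ = Φ a := by field_simp
  refine ⟨(p ^ 2 + 1) / m, by positivity, fun r hr y hy => ?_⟩
  have hb : |r.eval y| ≤ p * ‖fun i : Fin p => r.coeff i‖ := by
    rw [heval r hr y]
    refine (Finset.abs_sum_le_sum_abs _ _).trans ?_
    have : ∀ i ∈ (Finset.univ : Finset (Fin p)),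
        |r.coeff i * y ^ (i : ℕ)| ≤ ‖fun i : Fin p => r.coeff i‖ := by
      intro i _
      rw [abs_mul]
      have h1 : |y ^ (i : ℕ)| ≤ 1 := by
        rw [abs_pow]
        exact pow_le_one₀ (abs_nonneg _) (abs_le.2 ⟨by linarith [hy.1], hy.2⟩)
      calc |r.coeff i| * |y ^ (i : ℕ)| ≤ |r.coeff i| * 1 := by gcongr
        _ = ‖(fun i : Fin p => r.coeff i) i‖ := by simp
        _ ≤ _ := norm_le_pi_norm (fun i : Fin p => r.coeff i) i
    simpa using Finset.sum_le_sum this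
  have h2 : Φ (fun i : Fin p => r.coeff i) = ∫ x in (0 : ℝ)..1, x * (r.eval x) ^ 2 := by
    simp only [Φ, heval r hr]
  have h3 := hmle (fun i : Fin p => r.coeff i)
  rw [← h2]
  set n := ‖fun i : Fin p => r.coeff i‖
  calc (r.eval y) ^ 2 = |r.eval y| ^ 2 := (sq_abs _).symm
    _ ≤ (p * n) ^ 2 := by gcongr
    _ ≤ (p ^ 2 + 1) / m * (m * n ^ 2) := by
        rw [div_mul_eq_mul_div, le_div_iff₀ hm]
        nlinarith [sq_nonneg n, mul_nonneg hm.le (sq_nonneg n)]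
    _ ≤ _ := by gcongr

/-- Uniform stability of the local projection with vanishing initial value. -/
theorem exists_abs_eval_one_le (p : ℕ) :
    ∃ K : ℝ, 0 < K ∧ ∀ (θ : ℝ), 0 ≤ θ → θ ≤ 1 → ∀ (f : ℝ → ℝ) (F : ℝ) (P : Polynomial ℝ),
      (∀ x ∈ Icc (0 : ℝ) 1, |f x| ≤ F) → IsLocalProj θ p 0 f P → |P.eval 1| ≤ K * F := by
  obtain ⟨K, hK, hKle⟩ := exists_eval_sq_le_integral p
  refine ⟨K * Real.exp 1, by positivity, fun θ h0 h1 f F P hf hP => ?_⟩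
  obtain ⟨r, hr, rfl⟩ := exists_eq_X_mul_of_eval_zero hP.mem hP.init
  have hF : 0 ≤ F := (abs_nonneg _).trans (hf 0 ⟨le_rfl, zero_le_one⟩)
  obtain ⟨y, hy, hmax⟩ := (isCompact_Icc (a := (0 : ℝ)) (b := 1)).exists_isMaxOn
    (nonempty_Icc.2 zero_le_one) (f := fun x => |r.eval x|) (by fun_prop)
  set m := |r.eval y| with hm
  have hm0 : 0 ≤ m := abs_nonneg _
  have hle : ∀ x ∈ Icc (0 : ℝ) 1, |r.eval x| ≤ m := fun x hx => hmax hx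
  set I := ∫ x in (0 : ℝ)..1, x * (r.eval x) ^ 2 with hI
  have h2 : m ^ 2 ≤ K * I := by rw [hm, sq_abs]; exact hKle r hr y hy
  have h3 : Real.exp (-1) * I ≤ ∫ x in (0 : ℝ)..1,
      (Polynomial.X * r).eval x * (Real.exp (-(θ * x)) * r.eval x) := by
    rw [hI, ← intervalIntegral.integral_const_mul]
    refine intervalIntegral.integral_mono_on zero_le_one
      (Continuous.intervalIntegrable (by fun_prop) _ _)
      (intervalIntegrable_eval_mul_exp_mul_eval θ _ _) fun x hx => ?_
    have : Real.exp (-1) ≤ Real.exp (-(θ * x)) :=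
      Real.exp_le_exp.2 (by nlinarith [hx.1, hx.2])
    calc Real.exp (-1) * (x * r.eval x ^ 2) ≤ Real.exp (-(θ * x)) * (x * r.eval x ^ 2) :=
          mul_le_mul_of_nonneg_right this (mul_nonneg hx.1 (sq_nonneg _))
      _ = _ := by simp only [Polynomial.eval_mul, Polynomial.eval_X]; ring
  have h4 : |∫ x in (0 : ℝ)..1, f x * (Real.exp (-(θ * x)) * r.eval x)| ≤ F * m := by
    have := intervalIntegral.norm_integral_le_of_norm_le_const (a := (0 : ℝ)) (b := 1)
      (f := fun x => f x * (Real.exp (-(θ * x)) * r.eval x)) (C := F * m) (fun x hx => by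
        rw [uIoc_of_le zero_le_one] at hx
        have hx' : x ∈ Icc (0 : ℝ) 1 := ⟨hx.1.le, hx.2⟩
        rw [Real.norm_eq_abs, abs_mul, abs_mul, Real.abs_exp]
        have : Real.exp (-(θ * x)) ≤ 1 :=
          Real.exp_le_one_iff.2 (by nlinarith [hx'.1])
        calc |f x| * (Real.exp (-(θ * x)) * |r.eval x|) ≤ F * (1 * m) := by
              gcongr
              · exact hf x hx'
              · exact hle x hx'
          _ = F * m := by ring)
    simpa using this
  rw [hP.orth r hr] at h3
  have h5 : Real.exp (-1) * I ≤ F * m := h3.trans ((le_abs_self _).trans h4)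
  have h6 : I ≤ Real.exp 1 * (F * m) := by
    calc I = Real.exp 1 * (Real.exp (-1) * I) := by
          rw [← mul_assoc, ← Real.exp_add]; simp
      _ ≤ _ := by gcongr
  have h7 : m ≤ K * Real.exp 1 * F := by
    rcases hm0.eq_or_lt with h | h
    · rw [← h]; positivity
    · have : m * m ≤ (K * Real.exp 1 * F) * m := by
        calc m * m = m ^ 2 := by ring
          _ ≤ K * I := h2
          _ ≤ K * (Real.exp 1 * (F * m)) := by gcongr
          _ = _ := by ring
      exact le_of_mul_le_mul_right this h
  have h8 : (Polynomial.X * r).eval 1 = r.eval 1 := by simp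
  rw [h8]
  exact (hle 1 ⟨zero_le_one, le_rfl⟩).trans h7

/-- The amplification factor: testing with `z'` turns orthogonality into
`z(1)² e^{-θ} - z(0)² = -θ ∫ z² e^{-θ x} ≤ 0`. -/
theorem IsLocalProj.eval_one_sq_le {θ : ℝ} (hθ : 0 ≤ θ) {p : ℕ} {z : Polynomial ℝ}
    (hz : IsLocalProj θ p 1 (fun _ => 0) z) : (z.eval 1) ^ 2 ≤ Real.exp θ := by
  have hd : z.derivative ∈ Polynomial.degreeLT ℝ p := by
    rw [Polynomial.mem_degreeLT]
    by_cases h0 : z.derivative = 0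
    · rw [h0, Polynomial.degree_zero]; exact WithBot.bot_lt_coe p
    have hm := hz.mem
    have hz0 : z ≠ 0 := by rintro rfl; simp at h0
    have hn : z.natDegree ≠ 0 := fun h => h0 (Polynomial.derivative_of_natDegree_zero h)
    rw [Polynomial.mem_degreeLT, Polynomial.degree_eq_natDegree hz0] at hm
    rw [Polynomial.degree_eq_natDegree h0]
    have := Polynomial.natDegree_derivative_lt hn
    norm_cast at hm ⊢
    omega
  have ho := hz.orth _ hd
  simp only [zero_mul, intervalIntegral.integral_zero] at ho
  have hder : ∀ x ∈ uIcc (0 : ℝ) 1, HasDerivAt (fun x => (z.eval x) ^ 2 * Real.exp (-(θ * x)))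
      (2 * (z.eval x * (Real.exp (-(θ * x)) * z.derivative.eval x))
        - θ * (Real.exp (-(θ * x)) * (z.eval x) ^ 2)) x := by
    intro x _
    have h1 := (z.hasDerivAt x).pow 2
    have h2 : HasDerivAt (fun x => Real.exp (-(θ * x))) (Real.exp (-(θ * x)) * (-(θ * 1))) x :=
      (((hasDerivAt_id x).const_mul θ).neg).exp
    refine (h1.mul h2).congr_deriv ?_
    simp only [Pi.pow_apply]
    push_cast
    ring
  have hi1 : IntervalIntegrable (fun x => 2 * (z.eval x * (Real.exp (-(θ * x)) *
      z.derivative.eval x))) volume 0 1 := Continuous.intervalIntegrable (by fun_prop) _ _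
  have hi2 : IntervalIntegrable (fun x => θ * (Real.exp (-(θ * x)) * (z.eval x) ^ 2)) volume 0 1 :=
    Continuous.intervalIntegrable (by fun_prop) _ _
  have hftc := intervalIntegral.integral_eq_sub_of_hasDerivAt hder (hi1.sub hi2)
  rw [intervalIntegral.integral_sub hi1 hi2, intervalIntegral.integral_const_mul, ho,
    intervalIntegral.integral_const_mul] at hftc
  have hnn : 0 ≤ ∫ x in (0 : ℝ)..1, Real.exp (-(θ * x)) * (z.eval x) ^ 2 :=
    intervalIntegral.integral_nonneg zero_le_one fun x _ => by positivity
  simp only [hz.init, mul_one, mul_zero, neg_zero, Real.exp_zero, one_pow] at hftc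
  have h3 : (z.eval 1) ^ 2 * Real.exp (-θ) ≤ 1 := by nlinarith [mul_nonneg hθ hnn]
  calc (z.eval 1) ^ 2 = (z.eval 1) ^ 2 * Real.exp (-θ) * Real.exp θ := by
        rw [mul_assoc, ← Real.exp_add]; simp
    _ ≤ 1 * Real.exp θ := by gcongr
    _ = _ := one_mul _

/-- The product `q` of the linear factors of `f` at its roots in `(0, 1)`, up to a constant, satisfies
`q f ≥ 0`; each of these factors changes sign between `0` and `1`. -/
theorem exists_dvd_mul_nonneg (n : ℕ) : ∀ f : Polynomial ℝ, f ≠ 0 → f.natDegree ≤ n →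
    ∃ q : Polynomial ℝ, q ∣ f ∧ (∀ x ∈ Icc (0 : ℝ) 1, 0 ≤ f.eval x * q.eval x) ∧
      0 < (-1) ^ q.natDegree * (q.eval 0 * q.eval 1) := by
  induction n with
  | zero =>
    intro f hf hn
    obtain ⟨a, rfl⟩ := Polynomial.natDegree_eq_zero.1 (Nat.le_zero.1 hn)
    have ha : a ≠ 0 := by rintro rfl; simp at hf
    refine ⟨Polynomial.C a, dvd_rfl, fun x _ => ?_, ?_⟩
    · simpa using mul_self_nonneg a
    · simpa using mul_self_pos.2 ha
  | succ n ih =>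
    intro f hf hn
    by_cases hroot : ∃ s ∈ Ioo (0 : ℝ) 1, f.eval s = 0
    · obtain ⟨s, hs, h0⟩ := hroot
      obtain ⟨g, rfl⟩ := Polynomial.dvd_iff_isRoot.2 h0
      have hg : g ≠ 0 := right_ne_zero_of_mul hf
      have hX := Polynomial.X_sub_C_ne_zero s
      rw [Polynomial.natDegree_mul hX hg, Polynomial.natDegree_X_sub_C] at hn
      obtain ⟨q, hq, hnn, hpos⟩ := ih g hg (by omega)
      have hq0 : q ≠ 0 := by rintro rfl; simp at hpos
      refine ⟨(Polynomial.X - Polynomial.C s) * q, mul_dvd_mul_left _ hq, fun x hx => ?_, ?_⟩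
      · have := mul_nonneg (mul_self_nonneg (x - s)) (hnn x hx)
        simp only [Polynomial.eval_mul, Polynomial.eval_sub, Polynomial.eval_X, Polynomial.eval_C]
        linarith
      · rw [Polynomial.natDegree_mul hX hq0, Polynomial.natDegree_X_sub_C, pow_add]
        have := mul_pos (mul_pos hs.1 (sub_pos.2 hs.2)) hpos
        simp only [Polynomial.eval_mul, Polynomial.eval_sub, Polynomial.eval_X, Polynomial.eval_C]
        linarith
    · push Not at hroot
      -- without interior roots the sign of `f` on `(0, 1)` is that of `f (1 / 2)`
      have hh : f.eval (1 / 2) ≠ 0 := hroot _ (by norm_num)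
      refine ⟨Polynomial.C (f.eval (1 / 2)), ?_, fun x hx => ?_, ?_⟩
      · exact (Polynomial.isUnit_C.2 hh.isUnit).dvd
      · have hIoo : ∀ x ∈ Ioo (0 : ℝ) 1, 0 ≤ f.eval x * f.eval (1 / 2) := by
          intro x hx
          by_contra! hneg
          have hpc : IsPreconnected ((fun x => f.eval x * f.eval (1 / 2)) '' Ioo (0 : ℝ) 1) :=
            isPreconnected_Ioo.image _ (by fun_prop)
          obtain ⟨y, hy, hy0⟩ := hpc.ordConnected.out (mem_image_of_mem _ hx)
            (mem_image_of_mem _ (by norm_num : (1 / 2 : ℝ) ∈ Ioo (0 : ℝ) 1))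
            (mem_Icc.2 ⟨hneg.le, mul_self_nonneg _⟩)
          exact mul_ne_zero (hroot y hy) hh hy0
        have hcl : closure (Ioo (0 : ℝ) 1) ⊆ {x | 0 ≤ f.eval x * f.eval (1 / 2)} :=
          closure_minimal hIoo (isClosed_le continuous_const (by fun_prop))
        rw [closure_Ioo zero_ne_one] at hcl
        simpa using hcl hx
      · simpa using mul_self_pos.2 hh

/-- For odd `p` the orthogonal polynomial of degree `p` has opposite signs at `0` and `1`, since
all its roots lie in `(0, 1)`. -/
theorem IsLocalProj.eval_one_neg {θ : ℝ} {p : ℕ} (hp : Odd p) {z : Polynomial ℝ}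
    (hz : IsLocalProj θ p 1 (fun _ => 0) z) : z.eval 1 < 0 := by
  have hz0 : z ≠ 0 := by rintro rfl; simpa using hz.init
  obtain ⟨q, hqz, hnn, hpos⟩ := exists_dvd_mul_nonneg _ z hz0 le_rfl
  have hq0 : q ≠ 0 := by rintro rfl; simp at hpos
  have hzp : z.natDegree ≤ p := by
    have := hz.mem
    rw [Polynomial.mem_degreeLT, Polynomial.degree_eq_natDegree hz0] at this
    norm_cast at this
    omega
  -- a factor of degree less than `p` is an admissible test function
  have hqp : ¬ q.natDegree < p := by
    intro hlt
    have ho := hz.orth q (by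
      rw [Polynomial.mem_degreeLT, Polynomial.degree_eq_natDegree hq0]
      exact_mod_cast hlt)
    have := integral_exp_mul_eval_pos θ (mul_ne_zero hz0 hq0) (fun x hx => by
      rw [Polynomial.eval_mul]; exact hnn x hx)
    simp only [zero_mul, intervalIntegral.integral_zero] at ho
    refine absurd ho (ne_of_gt (this.trans_eq ?_))
    refine intervalIntegral.integral_congr fun x _ => ?_
    simp only [Polynomial.eval_mul]
    ring
  obtain ⟨g, rfl⟩ := hqz
  have hg : g ≠ 0 := right_ne_zero_of_mul hz0
  rw [Polynomial.natDegree_mul hq0 hg] at hzp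
  obtain ⟨a, rfl⟩ := Polynomial.natDegree_eq_zero.1 (show g.natDegree = 0 by omega)
  have hqd : q.natDegree = p := by omega
  rw [hqd, hp.neg_one_pow] at hpos
  have hi := hz.init
  simp only [Polynomial.eval_mul, Polynomial.eval_C] at hi ⊢
  have ha : a ≠ 0 := by rintro rfl; simp at hg
  have h1 : 0 < a ^ 2 := by positivity
  calc q.eval 1 * a = (q.eval 0 * a) * (q.eval 1 * a) := by rw [hi, one_mul]
    _ = a ^ 2 * (q.eval 0 * q.eval 1) := by ring
    _ < 0 := by nlinarith

/-! ### Sobolev functions on an interval -/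

instance isFiniteMeasure_volT (T : ℝ) : IsFiniteMeasure (volT T) := by
  unfold volT
  infer_instance

theorem integral_volT {T : ℝ} (hT : 0 ≤ T) (f : ℝ → ℝ) :
    ∫ t, f t ∂(volT T) = ∫ t in (0 : ℝ)..T, f t := by
  rw [intervalIntegral.integral_of_le hT, integral_Ioc_eq_integral_Ioo, volT]

theorem ae_volT_mem (T : ℝ) : ∀ᵐ t ∂(volT T), t ∈ Ioo 0 T :=
  ae_restrict_mem measurableSet_Ioo

theorem integrable_volT_iff {T : ℝ} (hT : 0 ≤ T) {f : ℝ → ℝ} :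
    Integrable f (volT T) ↔ IntervalIntegrable f volume 0 T := by
  rw [intervalIntegrable_iff_integrableOn_Ioo_of_le hT]
  rfl

theorem eqOn_Icc_of_ae_volT {T : ℝ} (hT : 0 < T) {f g : ℝ → ℝ} (hf : ContinuousOn f (Icc 0 T))
    (hg : ContinuousOn g (Icc 0 T)) (h : f =ᵐ[volT T] g) : EqOn f g (Icc 0 T) := by
  refine Measure.eqOn_Icc_of_ae_eq (μ := volume) hT.ne ?_ hf hg
  rw [← restrict_Ioo_eq_restrict_Icc]
  exact h

theorem le_on_Icc_of_ae_volT {T : ℝ} (hT : 0 < T) {f : ℝ → ℝ} {B : ℝ}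
    (hf : ContinuousOn f (Icc 0 T)) (h : ∀ᵐ t ∂(volT T), f t ≤ B) : ∀ t ∈ Icc 0 T, f t ≤ B := by
  have := eqOn_Icc_of_ae_volT hT (hf.sup (continuousOn_const (c := B))) continuousOn_const
    (h.mono fun t ht => sup_eq_right.2 ht)
  exact fun t ht => sup_eq_right.1 (this ht)

theorem IsContRep.eqOn {T : ℝ} (hT : 0 < T) {v c c' : ℝ → ℝ} (h : IsContRep T v c)
    (h' : IsContRep T v c') : EqOn c c' (Icc 0 T) :=
  eqOn_Icc_of_ae_volT hT h.1 h'.1 (h.2.symm.trans h'.2)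

theorem IsContRep.congr {T : ℝ} {v c c' : ℝ → ℝ} (h : IsContRep T v c)
    (h' : EqOn c' c (Icc 0 T)) : IsContRep T v c' := by
  refine ⟨h.1.congr h', ?_⟩
  filter_upwards [h.2, ae_volT_mem T] with t ht hm
  rw [ht, h' (Ioo_subset_Icc_self hm)]

/-- A smooth test function in `(0, T)` of mean zero is the derivative of a test function. -/
theorem exists_testFunction_deriv_eq {T : ℝ} (hT : 0 < T) {ψ : ℝ → ℝ} (hψ : ContDiff ℝ ∞ ψ)
    (hc : HasCompactSupport ψ) (hs : tsupport ψ ⊆ Ioo 0 T) (h0 : ∫ t in (0 : ℝ)..T, ψ t = 0) :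
    ∃ φ : ℝ → ℝ, ContDiff ℝ ∞ φ ∧ HasCompactSupport φ ∧ tsupport φ ⊆ Ioo 0 T ∧ deriv φ = ψ := by
  -- the support is contained in a compact interval `[a, b]` inside `(0, T)`
  obtain ⟨a, b, ha, hb, hab⟩ : ∃ a b : ℝ, 0 < a ∧ b < T ∧ tsupport ψ ⊆ Icc a b := by
    rcases (tsupport ψ).eq_empty_or_nonempty with he | hne
    · exact ⟨T / 2, T / 2, by positivity, by linarith, by simp [he]⟩
    · obtain ⟨a, ha⟩ := IsCompact.exists_isLeast hc hne
      obtain ⟨b, hb⟩ := IsCompact.exists_isGreatest hc hne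
      exact ⟨a, b, (hs ha.1).1, (hs hb.1).2, fun x hx => ⟨ha.2 hx, hb.2 hx⟩⟩
  have hz : ∀ x, x ∉ Icc a b → ψ x = 0 := fun x hx => image_eq_zero_of_notMem_tsupport
    fun h => hx (hab h)
  have hint : ∀ x y : ℝ, IntervalIntegrable ψ volume x y := fun x y =>
    hψ.continuous.intervalIntegrable x y
  have hder : deriv (fun u => ∫ t in (0 : ℝ)..u, ψ t) = ψ := by
    funext u
    exact hψ.continuous.deriv_integral ψ 0 u
  have hsupp : tsupport (fun u => ∫ t in (0 : ℝ)..u, ψ t) ⊆ Icc a b := by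
    refine closure_minimal (fun u hu => ?_) isClosed_Icc
    by_contra hn
    refine hu ?_
    rcases not_and_or.1 hn with h | h
    · push Not at h
      calc ∫ t in (0 : ℝ)..u, ψ t = ∫ t in (0 : ℝ)..u, (0 : ℝ) := by
            refine intervalIntegral.integral_congr fun t ht => hz t fun h' => ?_
            have := ht.2
            have h2 : max 0 u < a := max_lt ha h
            linarith [h'.1]
        _ = 0 := by simp
    · push Not at h
      have h1 : ∫ t in u..T, ψ t = 0 := by
        calc ∫ t in u..T, ψ t = ∫ t in u..T, (0 : ℝ) := by
              refine intervalIntegral.integral_congr fun t ht => hz t fun h' => ?_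
              have := ht.1
              have h2 : b < min u T := lt_min h hb
              linarith [h'.2]
          _ = 0 := by simp
      have h2 := intervalIntegral.integral_add_adjacent_intervals (hint 0 u) (hint u T)
      show ∫ t in (0 : ℝ)..u, ψ t = 0
      linarith
  refine ⟨fun u => ∫ t in (0 : ℝ)..u, ψ t, ?_, ?_, ?_, hder⟩
  · refine contDiff_infty_iff_deriv.2 ⟨fun u => ?_, by rw [hder]; exact hψ⟩
    exact (intervalIntegral.integral_hasDerivAt_right (hint 0 u)
      (hψ.continuous.stronglyMeasurableAtFilter _ _) hψ.continuous.continuousAt).differentiableAt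
  · exact HasCompactSupport.of_support_subset_isCompact isCompact_Icc
      ((subset_tsupport _).trans hsupp)
  · exact hsupp.trans fun x hx => ⟨ha.trans_le hx.1, hx.2.trans_lt hb⟩

theorem integral_volT_eq_integral {T : ℝ} {ψ : ℝ → ℝ} (hs : tsupport ψ ⊆ Ioo 0 T) (f : ℝ → ℝ) :
    ∫ t, f t * ψ t ∂(volT T) = ∫ t, f t * ψ t := by
  refine setIntegral_eq_integral_of_forall_compl_eq_zero fun x hx => ?_
  rw [image_eq_zero_of_notMem_tsupport fun h => hx (hs h), mul_zero]

theorem exists_testFunction_integral_eq_one {T : ℝ} (hT : 0 < T) :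
    ∃ η : ℝ → ℝ, ContDiff ℝ ∞ η ∧ HasCompactSupport η ∧ tsupport η ⊆ Ioo 0 T ∧
      ∫ t, η t ∂(volT T) = 1 := by
  let b : ContDiffBump (T / 2) := ⟨T / 8, T / 4, by positivity, by linarith⟩
  have hs : tsupport (b.normed volume) ⊆ Ioo 0 T := by
    rw [b.tsupport_normed_eq, Real.closedBall_eq_Icc]
    intro x hx
    have h1 := hx.1
    have h2 := hx.2
    simp only [b] at h1 h2
    constructor <;> linarith
  refine ⟨b.normed volume, b.contDiff_normed, b.hasCompactSupport_normed, hs, ?_⟩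
  have := integral_volT_eq_integral hs (fun _ => 1)
  simp only [one_mul] at this
  rw [this, b.integral_normed]

theorem integrable_mul_volT {T : ℝ} (hT : 0 ≤ T) {f ψ : ℝ → ℝ}
    (hf : Integrable f (volT T)) (hψ : Continuous ψ) :
    Integrable (fun t => f t * ψ t) (volT T) := by
  rw [integrable_volT_iff hT] at hf ⊢
  exact hf.mul_continuousOn hψ.continuousOn

/-- The du Bois-Reymond lemma: an integrable function that annihilates the derivatives of all test
functions is constant almost everywhere. -/
theorem ae_eq_const_of_integral_mul_deriv_eq_zero {T : ℝ} (hT : 0 < T) {f : ℝ → ℝ}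
    (hf : Integrable f (volT T))
    (h : ∀ φ : ℝ → ℝ, ContDiff ℝ ∞ φ → HasCompactSupport φ → tsupport φ ⊆ Ioo 0 T →
      ∫ t, f t * deriv φ t ∂(volT T) = 0) :
    ∃ k : ℝ, ∀ᵐ t ∂(volT T), f t = k := by
  obtain ⟨η, hη, hηc, hηs, hη1⟩ := exists_testFunction_integral_eq_one hT
  refine ⟨∫ t, f t * η t ∂(volT T), ?_⟩
  set k := ∫ t, f t * η t ∂(volT T) with hk
  have hfk : Integrable (fun t => f t - k) (volT T) := hf.sub (integrable_const k)
  have key := isOpen_Ioo.ae_eq_zero_of_integral_contDiff_smul_eq_zero (μ := volT T) (U := Ioo 0 T)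
    (hfk.locallyIntegrable.locallyIntegrableOn _) (fun ψ hψ hψc hψs => ?_)
  · filter_upwards [key, ae_volT_mem T] with t ht hm
    exact sub_eq_zero.1 (ht hm)
  · set m := ∫ t, ψ t ∂(volT T) with hm
    have hicont : ∀ u : ℝ → ℝ, Continuous u → Integrable u (volT T) := fun u hu =>
      (integrable_volT_iff hT.le).2 (hu.intervalIntegrable _ _)
    have hζc : HasCompactSupport (fun t => m * η t) := hηc.mul_left
    obtain ⟨φ, hφ, hφc, hφs, hφd⟩ := exists_testFunction_deriv_eq hT
      (ψ := fun t => ψ t - m * η t) (hψ.sub (contDiff_const.mul hη)) (hψc.sub hζc)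
      ((tsupport_sub ψ (fun t => m * η t)).trans (union_subset hψs
        ((tsupport_mul_subset_right (f := fun _ => m) (g := η)).trans hηs))) (by
        rw [← integral_volT hT.le, integral_sub (hicont _ hψ.continuous)
          (hicont (fun t => m * η t) (continuous_const.mul hη.continuous)), integral_const_mul, hη1, mul_one, hm,
          sub_self])
    have h1 := h φ hφ hφc hφs
    rw [hφd] at h1
    have hfψ := integrable_mul_volT hT.le hf hψ.continuous
    have hfη := integrable_mul_volT hT.le hf hη.continuous
    have h2 : ∫ t, f t * (ψ t - m * η t) ∂(volT T) = (∫ t, f t * ψ t ∂(volT T)) - m * k := by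
      rw [hk, ← integral_const_mul, ← integral_sub hfψ (hfη.const_mul m)]
      congr 1
      funext t
      ring
    have h3 : ∫ t, ψ t • (f t - k) ∂(volT T) = (∫ t, f t * ψ t ∂(volT T)) - k * m := by
      rw [hm, ← integral_const_mul, ← integral_sub hfψ ((hicont _ hψ.continuous).const_mul k)]
      congr 1
      funext t
      simp only [smul_eq_mul]
      ring
    rw [h3]
    linarith

theorem integrable_indicator_volT {T : ℝ} {g : ℝ → ℝ} (hg : Integrable g (volT T)) :
    Integrable ((Ioo 0 T).indicator g) volume :=
  (integrable_indicator_iff measurableSet_Ioo).2 hg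

/-- A function with an integrable weak derivative `g` is represented by a primitive of `g`. The
indicator makes the primitive continuous on the whole line. -/
theorem HasWeakDeriv.exists_isContRep {T : ℝ} (hT : 0 < T) {f g : ℝ → ℝ}
    (hf : Integrable f (volT T)) (hg : Integrable g (volT T)) (h : HasWeakDeriv T f g) :
    ∃ k : ℝ, IsContRep T f (fun t => k + ∫ s in (0 : ℝ)..t, (Ioo 0 T).indicator g s) := by
  have hi := integrable_indicator_volT hg
  set G : ℝ → ℝ := fun t => ∫ s in (0 : ℝ)..t, (Ioo 0 T).indicator g s with hG
  have hGc : Continuous G := intervalIntegral.continuous_primitive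
    (fun a b => hi.intervalIntegrable) 0
  have hGi : Integrable G (volT T) :=
    (integrable_volT_iff hT.le).2 (hGc.intervalIntegrable _ _)
  obtain ⟨k, hk⟩ := ae_eq_const_of_integral_mul_deriv_eq_zero hT (hf.sub hGi)
    (fun φ hφ hφc hφs => by
      have hφ1 : ContDiff ℝ 1 φ := hφ.of_le (by simp)
      have hφ' : Continuous (deriv φ) := hφ1.continuous_deriv_one
      have hGa : AbsolutelyContinuousOnInterval G 0 T :=
        hi.intervalIntegrable.absolutelyContinuousOnInterval_intervalIntegral (by simp)
      have hφa : AbsolutelyContinuousOnInterval φ 0 T :=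
        hφ1.contDiffOn.absolutelyContinuousOnInterval
      have hibp := hGa.integral_mul_deriv_eq_deriv_mul hφa
      have h0 : φ 0 = 0 := image_eq_zero_of_notMem_tsupport fun h => (hφs h).1.false
      have h1 : φ T = 0 := image_eq_zero_of_notMem_tsupport fun h => (hφs h).2.false
      have hGd : ∀ᵐ x, x ∈ uIcc 0 T → deriv G x = (Ioo 0 T).indicator g x := by
        filter_upwards [(hi.intervalIntegrable (a := 0) (b := T)).ae_hasDerivAt_integral] with x hx
        intro hm
        exact (hx hm 0 (by simp)).deriv
      have h2 : ∫ x in (0 : ℝ)..T, deriv G x * φ x = ∫ x, g x * φ x ∂(volT T) := by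
        rw [← integral_volT hT.le]
        refine integral_congr_ae ?_
        filter_upwards [ae_volT_mem T, ae_restrict_of_ae hGd] with x hx hx'
        rw [hx' (by rw [uIcc_of_le hT.le]; exact Ioo_subset_Icc_self hx),
          indicator_of_mem hx]
      rw [h0, h1, h2, ← integral_volT hT.le] at hibp
      have h3 := h.2.2 φ hφ hφc hφs
      have h4 := integral_sub (integrable_mul_volT hT.le hf hφ')
        (integrable_mul_volT hT.le hGi hφ')
      simp only [Pi.sub_apply, sub_mul]
      rw [h4]
      linarith)
  refine ⟨k, (continuous_const.add hGc).continuousOn, ?_⟩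
  filter_upwards [hk] with t ht
  simp only [Pi.sub_apply] at ht
  linarith

theorem MemH1.exists_isContRep {T : ℝ} (hT : 0 < T) {v : ℝ → ℝ} (hv : MemH1 T v) :
    ∃ c : ℝ → ℝ, Continuous c ∧ IsContRep T v c := by
  obtain ⟨hv2, g, hg2, hw⟩ := hv
  have hg := hg2.integrable one_le_two
  obtain ⟨k, hk⟩ := hw.exists_isContRep hT (hv2.integrable one_le_two) hg
  exact ⟨_, continuous_const.add (intervalIntegral.continuous_primitive
    (fun a b => (integrable_indicator_volT hg).intervalIntegrable) 0), hk⟩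

/-- The classical derivatives of order at most `n` of the continuous representative of a function
in `W_∞^{n+1}` extend continuously to `[0, T]`, and the one of order `n` is Lipschitz. -/
theorem MemWInf.exists_derivatives {T : ℝ} (hT : 0 < T) {n : ℕ} {v c : ℝ → ℝ}
    (hv : MemWInf T (n + 1) v) (hc : IsContRep T v c) :
    ∃ d : ℕ → ℝ → ℝ, (∀ j ≤ n, Continuous (d j)) ∧ EqOn c (d 0) (Icc 0 T) ∧
      (∀ j ≤ n, EqOn (iteratedDeriv j c) (d j) (Ioo 0 T)) ∧
      (∀ j < n, ∀ t ∈ Ioo 0 T, HasDerivAt (d j) (d (j + 1) t) t) ∧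
      ∃ L : ℝ, ∀ s t : ℝ, |d n t - d n s| ≤ L * |t - s| := by
  obtain ⟨g, rfl, hg, hw⟩ := hv
  have hgi : ∀ j ≤ n + 1, Integrable (g j) (volT T) := fun j hj => (hg j hj).integrable le_top
  have hex : ∀ j, ∃ k : ℝ, j ≤ n → IsContRep T (g j)
      (fun t => k + ∫ s in (0 : ℝ)..t, (Ioo 0 T).indicator (g (j + 1)) s) := by
    intro j
    by_cases hj : j ≤ n
    · obtain ⟨k, hk⟩ := (hw j (by omega)).exists_isContRep hT (hgi j (by omega))
        (hgi (j + 1) (by omega))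
      exact ⟨k, fun _ => hk⟩
    · exact ⟨0, fun h => absurd h hj⟩
  choose k hk using hex
  set d : ℕ → ℝ → ℝ := fun j t => k j + ∫ s in (0 : ℝ)..t, (Ioo 0 T).indicator (g (j + 1)) s
    with hd
  have hii : ∀ j ≤ n, ∀ a b : ℝ,
      IntervalIntegrable ((Ioo 0 T).indicator (g (j + 1))) volume a b := fun j hj a b =>
    (integrable_indicator_volT (hgi (j + 1) (by omega))).intervalIntegrable
  have hdc : ∀ j ≤ n, Continuous (d j) := fun j hj =>
    continuous_const.add (intervalIntegral.continuous_primitive (hii j hj) 0)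
  have h0 : EqOn c (d 0) (Icc 0 T) := hc.eqOn hT (hk 0 (Nat.zero_le n))
  have hder : ∀ j < n, ∀ t ∈ Ioo 0 T, HasDerivAt (d j) (d (j + 1) t) t := by
    intro j hj t ht
    have heq : ∀ u ∈ Ioo 0 T, d j u = k j + ∫ s in (0 : ℝ)..u, d (j + 1) s := by
      intro u hu
      simp only [hd]
      congr 1
      refine intervalIntegral.integral_congr_ae ?_
      have h1 := (ae_restrict_iff' measurableSet_Ioo).1 (hk (j + 1) (by omega)).2
      filter_upwards [h1] with s hs hsu
      rw [uIoc_of_le hu.1.le] at hsu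
      have hm : s ∈ Ioo 0 T := ⟨hsu.1, hsu.2.trans_lt hu.2⟩
      rw [indicator_of_mem hm, hs hm]
    have hc1 := hdc (j + 1) (by omega)
    have h2 := (intervalIntegral.integral_hasDerivAt_right (hc1.intervalIntegrable 0 t)
      (hc1.stronglyMeasurableAtFilter _ _) hc1.continuousAt).const_add (k j)
    exact h2.congr_of_eventuallyEq (Filter.eventuallyEq_of_mem (Ioo_mem_nhds ht.1 ht.2) heq)
  have hiter : ∀ j ≤ n, EqOn (iteratedDeriv j c) (d j) (Ioo 0 T) := by
    intro j
    induction j with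
    | zero => intro _ t ht; rw [iteratedDeriv_zero]; exact h0 (Ioo_subset_Icc_self ht)
    | succ j ih =>
      intro hj t ht
      rw [iteratedDeriv_succ]
      have := (hder j (by omega) t ht).congr_of_eventuallyEq
        (Filter.eventuallyEq_of_mem (Ioo_mem_nhds ht.1 ht.2) (ih (by omega)))
      exact this.deriv
  refine ⟨d, hdc, h0, hiter, hder, (eLpNormEssSup (g (n + 1)) (volT T)).toReal, fun s t => ?_⟩
  have hfin : eLpNormEssSup (g (n + 1)) (volT T) < ⊤ := by
    have := (hg (n + 1) le_rfl).2
    rwa [eLpNorm_exponent_top] at this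
  have hb : ∀ᵐ x, ‖(Ioo 0 T).indicator (g (n + 1)) x‖ ≤
      (eLpNormEssSup (g (n + 1)) (volT T)).toReal := by
    have h1 := (ae_restrict_iff' measurableSet_Ioo).1
      (enorm_ae_le_eLpNormEssSup (g (n + 1)) (volT T))
    filter_upwards [h1] with x hx
    by_cases hm : x ∈ Ioo 0 T
    · rw [indicator_of_mem hm, ← toReal_enorm]
      exact ENNReal.toReal_mono hfin.ne (hx hm)
    · rw [indicator_of_notMem hm, norm_zero]
      exact ENNReal.toReal_nonneg
  have h2 : d n t - d n s = ∫ x in s..t, (Ioo 0 T).indicator (g (n + 1)) x := by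
    have := intervalIntegral.integral_interval_sub_left (hii n le_rfl 0 t) (hii n le_rfl 0 s)
    simp only [hd]
    linarith
  rw [h2, ← Real.norm_eq_abs]
  exact intervalIntegral.norm_integral_le_of_norm_le_const_ae (hb.mono fun x hx _ => hx)

theorem ae_abs_le_normLInf {T : ℝ} {f : ℝ → ℝ} {B : ℝ} (h : ∀ t ∈ Ioo 0 T, |f t| ≤ B) :
    ∀ᵐ t ∂(volT T), |f t| ≤ normLInf T f := by
  have hfin : eLpNormEssSup f (volT T) < ⊤ := eLpNormEssSup_lt_top_of_ae_bound (C := B)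
    ((ae_volT_mem T).mono fun t ht => h t ht)
  filter_upwards [enorm_ae_le_eLpNormEssSup f (volT T)] with t ht
  rw [normLInf, eLpNorm_exponent_top, ← Real.norm_eq_abs, ← toReal_enorm]
  exact ENNReal.toReal_mono hfin.ne ht

/-- For functions whose derivative of order `n + 1` exists everywhere, the derivatives of order
`n` and `n + 1` are controlled by their `L^∞` norms. The a priori Lipschitz bound makes these norms
finite, so that the fundamental theorem of calculus applies to the derivative of order `n`. -/
theorem MemWInfTilde.exists_derivatives {T : ℝ} (hT : 0 < T) {n : ℕ} {v c : ℝ → ℝ}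
    (hv : MemWInfTilde T (n + 1) v) (hc : IsContRep T v c) :
    ∃ d : ℕ → ℝ → ℝ, (∀ j ≤ n, Continuous (d j)) ∧ EqOn c (d 0) (Icc 0 T) ∧
      (∀ j < n, ∀ t ∈ Ioo 0 T, HasDerivAt (d j) (d (j + 1) t) t) ∧
      (∀ t ∈ Icc 0 T, |d n t| ≤ normLInf T (iteratedDeriv n c)) ∧
      ∀ s ∈ Icc 0 T, ∀ t ∈ Icc 0 T, s ≤ t →
        |d n t - d n s| ≤ normLInf T (iteratedDeriv (n + 1) c) * (t - s) := by
  obtain ⟨hW, c', hc', hdiff⟩ := hv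
  obtain ⟨d, hdc, h0, hiter, hder, L, hL⟩ := hW.exists_derivatives hT hc
  have hcc : EqOn c c' (Ioo 0 T) := (hc.eqOn hT hc').mono Ioo_subset_Icc_self
  have hD : ∀ t ∈ Ioo 0 T, HasDerivAt (d n) (iteratedDeriv (n + 1) c t) t := by
    intro t ht
    have h1 : EqOn (iteratedDeriv n c') (d n) (Ioo 0 T) :=
      (hcc.iteratedDeriv_of_isOpen isOpen_Ioo n).symm.trans (hiter n le_rfl)
    have hnhds := Ioo_mem_nhds ht.1 ht.2
    have h2 : DifferentiableAt ℝ (d n) t := (hdiff n (Nat.lt_succ_self n) t ht).congr_of_eventuallyEq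
      (Filter.eventuallyEq_of_mem hnhds h1.symm)
    have h3 := h2.hasDerivAt
    rwa [iteratedDeriv_succ, (Filter.eventuallyEq_of_mem hnhds (hiter n le_rfl)).deriv_eq]
  have hDb : ∀ t ∈ Ioo 0 T, |iteratedDeriv (n + 1) c t| ≤ L := by
    intro t ht
    have hL0 : 0 ≤ L := by simpa using (abs_nonneg _).trans (hL 0 1)
    have hlip : LipschitzWith L.toNNReal (d n) := LipschitzWith.of_dist_le_mul fun x y => by
      rw [Real.dist_eq, Real.dist_eq, Real.coe_toNNReal _ hL0]
      exact hL y x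
    have := norm_deriv_le_of_lipschitz (x₀ := t) hlip
    rwa [(hD t ht).deriv, Real.coe_toNNReal _ hL0] at this
  obtain ⟨B, hB⟩ := (isCompact_Icc (a := (0 : ℝ)) (b := T)).exists_bound_of_continuousOn
    (hdc n le_rfl).continuousOn
  refine ⟨d, hdc, h0, hder, ?_, fun s hs t ht hst => ?_⟩
  · refine le_on_Icc_of_ae_volT hT (hdc n le_rfl).abs.continuousOn ?_
    have := ae_abs_le_normLInf (T := T) (f := iteratedDeriv n c) (B := B) (fun t ht => by
      rw [hiter n le_rfl ht]; exact hB t (Ioo_subset_Icc_self ht))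
    filter_upwards [this, ae_volT_mem T] with t h1 h2
    rwa [hiter n le_rfl h2] at h1
  · have hae := (ae_restrict_iff' measurableSet_Ioo).1 (ae_abs_le_normLInf hDb)
    have hsub : Ioo s t ⊆ Ioo 0 T := Ioo_subset_Ioo hs.1 ht.2
    have hi : IntervalIntegrable (iteratedDeriv (n + 1) c) volume s t := by
      rw [intervalIntegrable_iff_integrableOn_Ioo_of_le hst]
      refine Measure.integrableOn_of_bounded (M := L) (by simp) ?_ ?_
      · rw [iteratedDeriv_succ]
        exact (measurable_deriv _).aestronglyMeasurable
      · exact (ae_restrict_iff' measurableSet_Ioo).2 (Filter.Eventually.of_forall fun x hx =>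
          hDb x (hsub hx))
    rw [← intervalIntegral.integral_eq_sub_of_hasDerivAt_of_le hst (hdc n le_rfl).continuousOn
      (fun x hx => hD x (hsub hx)) hi, ← Real.norm_eq_abs]
    refine (intervalIntegral.norm_integral_le_of_norm_le_const_ae
      (C := normLInf T (iteratedDeriv (n + 1) c)) ?_).trans_eq
      (by rw [abs_of_nonneg (sub_nonneg.2 hst)])
    filter_upwards [hae, Measure.ae_ne volume t] with x hx hxt hm
    rw [uIoc_of_le hst] at hm
    exact hx (hsub ⟨hm.1, lt_of_le_of_ne hm.2 hxt⟩)

/-- Taylor's formula at the left end point of an interval, with the remainder that a Lipschitz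
bound for the highest derivative gives. -/
theorem abs_sub_taylor_le {a b M : ℝ} (hM : 0 ≤ M) (n : ℕ) : ∀ d : ℕ → ℝ → ℝ,
    (∀ j ≤ n, Continuous (d j)) →
    (∀ j < n, ∀ t ∈ Ioo a b, HasDerivAt (d j) (d (j + 1) t) t) →
    (∀ t ∈ Icc a b, |d n t - d n a| ≤ M * (t - a)) →
    ∀ t ∈ Icc a b,
      |d 0 t - ∑ k ∈ Finset.range (n + 1), d k a / k.factorial * (t - a) ^ k|
        ≤ M * (t - a) ^ (n + 1) := by
  induction n with
  | zero => intro d _ _ h t ht; simpa using h t ht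
  | succ n ih =>
    intro d hc hd hL t ht
    have h1 := ih (fun j => d (j + 1)) (fun j hj => hc _ (by omega))
      (fun j hj => hd _ (by omega)) hL
    have hder : ∀ s, HasDerivAt
        (fun s => ∑ k ∈ Finset.range (n + 2), d k a / k.factorial * (s - a) ^ k)
        (∑ k ∈ Finset.range (n + 1), d (k + 1) a / k.factorial * (s - a) ^ k) s := by
      intro s
      simp only [Finset.sum_range_succ' _ (n + 1), pow_zero]
      refine HasDerivAt.add_const _ (HasDerivAt.fun_sum fun k _ => ?_)
      have := ((((hasDerivAt_id s).sub_const a).pow (k + 1)).const_mul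
        (d (k + 1) a / (k + 1).factorial))
      refine this.congr_deriv ?_
      rw [Nat.factorial_succ]
      have : (k.factorial : ℝ) ≠ 0 := by positivity
      push_cast
      simp only [id]
      field_simp
    set S : ℝ → ℝ := fun s => ∑ k ∈ Finset.range (n + 2), d k a / k.factorial * (s - a) ^ k
      with hS
    have hSc : Continuous S := by fun_prop
    have hi : ∀ x y : ℝ, IntervalIntegrable (fun s => d 1 s -
        ∑ k ∈ Finset.range (n + 1), d (k + 1) a / k.factorial * (s - a) ^ k) volume x y :=
      fun x y => Continuous.intervalIntegrable ((hc 1 (by omega)).sub (by fun_prop)) x y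
    have h2 := intervalIntegral.integral_eq_sub_of_hasDerivAt_of_le ht.1
      (f := fun s => d 0 s - S s) ((hc 0 (by omega)).sub hSc).continuousOn
      (fun s hs => (hd 0 (by omega) s ⟨hs.1, hs.2.trans_le ht.2⟩).sub (hder s)) (hi a t)
    have h3 : d 0 a - S a = 0 := by
      simp only [hS, Finset.sum_range_succ' _ (n + 1)]
      simp
    simp only [h3, sub_zero] at h2
    have hta : 0 ≤ t - a := sub_nonneg.2 ht.1
    rw [← h2, ← Real.norm_eq_abs]
    refine (intervalIntegral.norm_integral_le_of_norm_le_const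
      (C := M * (t - a) ^ (n + 1)) fun s hs => ?_).trans_eq (by
        rw [abs_of_nonneg hta]; ring)
    rw [uIoc_of_le ht.1] at hs
    refine (h1 s ⟨hs.1.le, hs.2.trans ht.2⟩).trans ?_
    have h4 : 0 ≤ s - a := by linarith [hs.1]
    have h5 : s - a ≤ t - a := by linarith [hs.2]
    gcongr

/-! ### From the mesh to the reference element -/

theorem mem_degreeLT_succ_iff {k : ℕ} {P : Polynomial ℝ} :
    P ∈ Polynomial.degreeLT ℝ (k + 1) ↔ P.natDegree ≤ k := by
  rw [Polynomial.mem_degreeLT, Polynomial.natDegree_le_iff_degree_le]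
  by_cases h : P = 0
  · simp only [h, Polynomial.degree_zero, bot_le, iff_true]
    exact WithBot.bot_lt_coe _
  · rw [Polynomial.degree_eq_natDegree h]
    norm_cast
    omega

theorem natDegree_comp_linear_le (P : Polynomial ℝ) (a b : ℝ) :
    (P.comp (Polynomial.C a + Polynomial.C b * Polynomial.X)).natDegree ≤ P.natDegree := by
  refine Polynomial.natDegree_comp_le.trans ?_
  have : (Polynomial.C a + Polynomial.C b * Polynomial.X).natDegree ≤ 1 := by
    rw [add_comm]
    exact Polynomial.natDegree_linear_le
  calc _ ≤ P.natDegree * 1 := Nat.mul_le_mul_left _ this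
    _ = _ := mul_one _

theorem meshNode_zero (T : ℝ) (N : ℕ) : meshNode T N 0 = 0 := by simp [meshNode]

theorem meshNode_self (T : ℝ) {N : ℕ} (hN : 1 ≤ N) : meshNode T N N = T := by
  have : (N : ℝ) ≠ 0 := by positivity
  rw [meshNode]
  field_simp

theorem meshNode_succ (T : ℝ) (N i : ℕ) : meshNode T N (i + 1) = meshNode T N i + T / N := by
  simp only [meshNode]
  push_cast
  ring

theorem meshNode_mono {T : ℝ} (hT : 0 < T) (N : ℕ) : Monotone (meshNode T N) := by
  intro i j hij
  simp only [meshNode]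
  gcongr

theorem meshNode_mem_Icc {T : ℝ} (hT : 0 < T) {N i : ℕ} (hN : 1 ≤ N) (hi : i ≤ N) :
    meshNode T N i ∈ Icc 0 T :=
  ⟨(meshNode_zero T N).symm.le.trans (meshNode_mono hT N (Nat.zero_le i)),
    (meshNode_mono hT N hi).trans (meshNode_self T hN).le⟩

theorem meshNode_add_mul_mem_Icc {T : ℝ} (hT : 0 < T) {N i : ℕ} {x : ℝ}
    (hx : x ∈ Icc (0 : ℝ) 1) :
    meshNode T N i + T / N * x ∈ Icc (meshNode T N i) (meshNode T N (i + 1)) := by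
  have h : 0 ≤ T / N := by positivity
  rw [meshNode_succ]
  constructor <;> nlinarith [hx.1, hx.2]

theorem meshNode_add_mul_mem_Ioo {T : ℝ} (hT : 0 < T) {N i : ℕ} (hN : 1 ≤ N) {x : ℝ}
    (hx : x ∈ Ioo (0 : ℝ) 1) :
    meshNode T N i + T / N * x ∈ Ioo (meshNode T N i) (meshNode T N (i + 1)) := by
  have h : 0 < T / N := by positivity
  rw [meshNode_succ]
  constructor <;> nlinarith [hx.1, hx.2]

theorem element_subset {T : ℝ} (hT : 0 < T) {N i : ℕ} (hi : i < N) :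
    Icc (meshNode T N i) (meshNode T N (i + 1)) ⊆ Icc 0 T :=
  Icc_subset_Icc (meshNode_mem_Icc hT (by omega) hi.le).1 (meshNode_mem_Icc hT (by omega) hi).2

theorem exists_eq_meshNode_add {T : ℝ} (hT : 0 < T) {N : ℕ} (hN : 1 ≤ N) {t : ℝ}
    (ht : t ∈ Ico 0 T) : ∃ i < N, ∃ x ∈ Ico (0 : ℝ) 1, t = meshNode T N i + T / N * x := by
  have hN' : (0 : ℝ) < N := by positivity
  have h0 : 0 ≤ t / T * N := mul_nonneg (div_nonneg ht.1 hT.le) hN'.le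
  refine ⟨⌊t / T * N⌋₊, ?_, t / T * N - ⌊t / T * N⌋₊, ⟨?_, ?_⟩, ?_⟩
  · rw [Nat.floor_lt h0]
    have : t / T < 1 := (div_lt_one hT).2 ht.2
    nlinarith
  · exact sub_nonneg.2 (Nat.floor_le h0)
  · have := Nat.lt_floor_add_one (t / T * N)
    linarith
  · simp only [meshNode]
    field_simp
    ring

theorem exists_mem_element {T : ℝ} (hT : 0 < T) {N : ℕ} (hN : 1 ≤ N) {t : ℝ}
    (ht : t ∈ Ioo 0 T) (hn : t ∉ range (meshNode T N)) :
    ∃ i < N, t ∈ Ioo (meshNode T N i) (meshNode T N (i + 1)) := by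
  obtain ⟨i, hi, x, hx, rfl⟩ := exists_eq_meshNode_add hT hN ⟨ht.1.le, ht.2⟩
  refine ⟨i, hi, meshNode_add_mul_mem_Ioo hT hN ⟨lt_of_le_of_ne hx.1 ?_, hx.2⟩⟩
  rintro rfl
  exact hn ⟨i, by simp⟩

theorem element_comp_continuousOn {T : ℝ} (hT : 0 < T) {N i : ℕ} (hi : i < N) {u : ℝ → ℝ}
    (hu : ContinuousOn u (Icc 0 T)) :
    ContinuousOn (fun x => u (meshNode T N i + T / N * x)) (Icc 0 1) :=
  hu.comp (by fun_prop) fun _ hx => element_subset hT hi (meshNode_add_mul_mem_Icc hT hx)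

/-- Weighted integrals against piecewise polynomials, as sums over the reference element. The
weight of the `i`-th element is a constant times the same weight `e^{-x / N}`. -/
theorem integral_mul_exp_mul_discPoly {T : ℝ} (hT : 0 < T) {N : ℕ} (hN : 1 ≤ N) {u q : ℝ → ℝ}
    (hu : ContinuousOn u (Icc 0 T)) {r : ℕ → Polynomial ℝ}
    (hq : ∀ i < N, ∀ t ∈ Ioo (meshNode T N i) (meshNode T N (i + 1)), q t = (r i).eval t) :
    ∫ t, u t * (Real.exp (-t / T) * q t) ∂(volT T) =
      ∑ i ∈ Finset.range N, T / N * (Real.exp (-(i / N)) *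
        ∫ x in (0 : ℝ)..1, u (meshNode T N i + T / N * x) *
          (Real.exp (-(1 / N * x)) * (r i).eval (meshNode T N i + T / N * x))) := by
  have hN' : (0 : ℝ) < N := by positivity
  have hae : ∀ i < N, ∀ᵐ t, t ∈ uIoc (meshNode T N i) (meshNode T N (i + 1)) →
      u t * (Real.exp (-t / T) * q t) = u t * (Real.exp (-t / T) * (r i).eval t) := by
    intro i hi
    filter_upwards [Measure.ae_ne volume (meshNode T N (i + 1))] with t ht hm
    rw [uIoc_of_le (meshNode_mono hT N (Nat.le_succ i))] at hm
    rw [hq i hi t ⟨hm.1, lt_of_le_of_ne hm.2 ht⟩]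
  have hint : ∀ i < N, IntervalIntegrable (fun t => u t * (Real.exp (-t / T) * q t)) volume
      (meshNode T N i) (meshNode T N (i + 1)) := by
    intro i hi
    have h1 : IntervalIntegrable (fun t => u t * (Real.exp (-t / T) * (r i).eval t)) volume
        (meshNode T N i) (meshNode T N (i + 1)) := by
      refine ContinuousOn.intervalIntegrable ?_
      rw [uIcc_of_le (meshNode_mono hT N (Nat.le_succ i))]
      exact (hu.mono (element_subset hT hi)).mul (by fun_prop)
    refine h1.congr_ae ((ae_restrict_iff' measurableSet_uIoc).2 ?_)
    filter_upwards [hae i hi] with t ht hm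
    exact (ht hm).symm
  have hsum := intervalIntegral.sum_integral_adjacent_intervals hint
  rw [meshNode_zero, meshNode_self T hN] at hsum
  rw [integral_volT hT.le, ← hsum]
  refine Finset.sum_congr rfl fun i hi => ?_
  rw [intervalIntegral.integral_congr_ae (hae i (Finset.mem_range.1 hi)),
    ← intervalIntegral.integral_const_mul (Real.exp _)]
  have h2 := intervalIntegral.mul_integral_comp_add_mul (a := 0) (b := 1)
    (f := fun t => u t * (Real.exp (-t / T) * (r i).eval t)) (c := T / N) (d := meshNode T N i)
  rw [mul_zero, add_zero, mul_one, ← meshNode_succ] at h2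
  rw [← h2]
  congr 1
  refine intervalIntegral.integral_congr fun x _ => ?_
  have h3 : Real.exp (-(meshNode T N i + T / N * x) / T) =
      Real.exp (-(i / N)) * Real.exp (-(1 / N * x)) := by
    rw [← Real.exp_add]
    congr 1
    simp only [meshNode]
    field_simp
    ring
  simp only [h3]
  ring

/-- Global orthogonality amounts to orthogonality on every element. -/
theorem orth_iff_local {T : ℝ} (hT : 0 < T) {N : ℕ} (hN : 1 ≤ N) {p : ℕ} (hp : 1 ≤ p)
    {u w : ℝ → ℝ} (hu : ContinuousOn u (Icc 0 T)) (hw : ContinuousOn w (Icc 0 T)) :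
    (∀ q ∈ DiscPoly T N (p - 1), ∫ t, w t * (Real.exp (-t / T) * q t) ∂(volT T) =
      ∫ t, u t * (Real.exp (-t / T) * q t) ∂(volT T)) ↔
    ∀ i < N, ∀ q ∈ Polynomial.degreeLT ℝ p,
      ∫ x in (0 : ℝ)..1, w (meshNode T N i + T / N * x) *
        (Real.exp (-(1 / N * x)) * q.eval x) =
      ∫ x in (0 : ℝ)..1, u (meshNode T N i + T / N * x) *
        (Real.exp (-(1 / N * x)) * q.eval x) := by
  obtain ⟨k, rfl⟩ : ∃ k, p = k + 1 := ⟨p - 1, by omega⟩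
  have hN' : (0 : ℝ) < N := by positivity
  rw [Nat.add_sub_cancel]
  constructor
  · intro h i hi q hq
    -- test with `q`, transported to the `i`-th element and extended by zero
    let r : ℕ → Polynomial ℝ := fun j => if j = i then
      q.comp (Polynomial.C (-(i : ℝ)) + Polynomial.C (N / T) * Polynomial.X) else 0
    let Q : ℝ → ℝ := fun t =>
      if t ∈ Ioo (meshNode T N i) (meshNode T N (i + 1)) then (r i).eval t else 0
    have hQ : ∀ j < N, ∀ t ∈ Ioo (meshNode T N j) (meshNode T N (j + 1)),
        Q t = (r j).eval t := by
      intro j _ t ht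
      by_cases hji : j = i
      · subst hji
        simp only [Q, if_pos ht]
      · have hnot : t ∉ Ioo (meshNode T N i) (meshNode T N (i + 1)) := by
          intro ht'
          rcases lt_or_gt_of_ne hji with hlt | hlt
          · have := meshNode_mono hT N (Nat.succ_le_of_lt hlt)
            exact absurd (ht.2.trans_le this) (not_lt.2 ht'.1.le)
          · have := meshNode_mono hT N (Nat.succ_le_of_lt hlt)
            exact absurd (ht'.2.trans_le this) (not_lt.2 ht.1.le)
        simp only [Q, if_neg hnot, r, if_neg hji, Polynomial.eval_zero]
    have hQm : Q ∈ DiscPoly T N k := by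
      refine fun j hj => ⟨r j, ?_, hQ j hj⟩
      by_cases hji : j = i
      · simp only [r, if_pos hji]
        exact (natDegree_comp_linear_le _ _ _).trans (mem_degreeLT_succ_iff.1 hq)
      · simp [r, if_neg hji]
    have h1 := h Q hQm
    rw [integral_mul_exp_mul_discPoly hT hN hw hQ, integral_mul_exp_mul_discPoly hT hN hu hQ] at h1
    have hother : ∀ v : ℝ → ℝ, ∀ j ∈ Finset.range N, j ≠ i →
        T / N * (Real.exp (-(j / N)) * ∫ x in (0 : ℝ)..1, v (meshNode T N j + T / N * x) *
          (Real.exp (-(1 / N * x)) * (r j).eval (meshNode T N j + T / N * x))) = 0 := by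
      intro v j _ hji
      simp [r, if_neg hji]
    rw [Finset.sum_eq_single_of_mem i (Finset.mem_range.2 hi) (hother w),
      Finset.sum_eq_single_of_mem i (Finset.mem_range.2 hi) (hother u)] at h1
    have h2 := mul_left_cancel₀ (Real.exp_ne_zero _) (mul_left_cancel₀ (by positivity) h1)
    have hev : ∀ x : ℝ, (r i).eval (meshNode T N i + T / N * x) = q.eval x := by
      intro x
      simp only [r, if_true, Polynomial.eval_comp, Polynomial.eval_add, Polynomial.eval_mul,
        Polynomial.eval_C, Polynomial.eval_X, meshNode]
      congr 1
      field_simp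
      ring
    simpa only [hev] using h2
  · intro h q hq
    have hex : ∀ i, ∃ r : Polynomial ℝ, i < N → r.natDegree ≤ k ∧
        ∀ t ∈ Ioo (meshNode T N i) (meshNode T N (i + 1)), q t = r.eval t := by
      intro i
      by_cases hi : i < N
      · obtain ⟨r, hr⟩ := hq i hi
        exact ⟨r, fun _ => hr⟩
      · exact ⟨0, fun h => absurd h hi⟩
    choose r hr using hex
    rw [integral_mul_exp_mul_discPoly hT hN hw fun i hi => (hr i hi).2,
      integral_mul_exp_mul_discPoly hT hN hu fun i hi => (hr i hi).2]
    refine Finset.sum_congr rfl fun i hi => ?_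
    have hi' := Finset.mem_range.1 hi
    have := h i hi' ((r i).comp (Polynomial.C (meshNode T N i) +
      Polynomial.C (T / N) * Polynomial.X)) (mem_degreeLT_succ_iff.2
        ((natDegree_comp_linear_le _ _ _).trans (hr i hi').1))
    simp only [Polynomial.eval_comp, Polynomial.eval_add, Polynomial.eval_mul,
        Polynomial.eval_C, Polynomial.eval_X] at this
    rw [this]

theorem integral_mul_volT_congr {T : ℝ} {v c : ℝ → ℝ} (h : IsContRep T v c) (f : ℝ → ℝ) :
    ∫ t, v t * f t ∂(volT T) = ∫ t, c t * f t ∂(volT T) :=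
  integral_congr_ae (h.2.mono fun t ht => by simp only [ht])

/-- On every element, the projection is the local projection with the initial value that it takes
at the left node. -/
theorem IsProj.exists_local {T : ℝ} (hT : 0 < T) {N : ℕ} (hN : 1 ≤ N) {p : ℕ} (hp : 1 ≤ p)
    {v c w : ℝ → ℝ} (hc : IsContRep T v c) (hw : IsProj T N p v w) {i : ℕ} (hi : i < N) :
    ∃ P : Polynomial ℝ, IsLocalProj (1 / N) p (w (meshNode T N i))
        (fun x => c (meshNode T N i + T / N * x)) P ∧
      ∀ x ∈ Icc (0 : ℝ) 1, w (meshNode T N i + T / N * x) = P.eval x := by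
  obtain ⟨hwc, hwp⟩ := hw.mem
  obtain ⟨r, hr, hwr⟩ := hwp i hi
  set P := r.comp (Polynomial.C (meshNode T N i) + Polynomial.C (T / N) * Polynomial.X) with hP
  have heq : EqOn (fun x => w (meshNode T N i + T / N * x)) (fun x => P.eval x) (Icc 0 1) := by
    have hIoo : EqOn (fun x => w (meshNode T N i + T / N * x)) (fun x => P.eval x) (Ioo 0 1) := by
      intro x hx
      simp only [hP, Polynomial.eval_comp, Polynomial.eval_add, Polynomial.eval_mul,
        Polynomial.eval_C, Polynomial.eval_X]
      exact hwr _ (meshNode_add_mul_mem_Ioo hT hN hx)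
    refine hIoo.of_subset_closure (element_comp_continuousOn hT hi hwc) P.continuousOn
      Ioo_subset_Icc_self ?_
    rw [closure_Ioo zero_ne_one]
  refine ⟨P, ⟨mem_degreeLT_succ_iff.2 ((natDegree_comp_linear_le _ _ _).trans hr), ?_, ?_⟩, heq⟩
  · simpa using (heq ⟨le_rfl, zero_le_one⟩).symm
  · intro q hq
    have h1 := (orth_iff_local hT hN hp hc.1 hwc).1 (fun q hq => by
      rw [hw.orth q hq, integral_mul_volT_congr hc]) i hi q hq
    rw [← h1]
    refine intervalIntegral.integral_congr fun x hx => ?_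
    rw [uIcc_of_le zero_le_one] at hx
    simp only [← heq hx]

theorem IsProj.unique {T : ℝ} (hT : 0 < T) {N : ℕ} (hN : 1 ≤ N) {p : ℕ} (hp : 1 ≤ p)
    {v c w w' : ℝ → ℝ} (hc : IsContRep T v c) (hw : IsProj T N p v w)
    (hw' : IsProj T N p v w') : EqOn w' w (Icc 0 T) := by
  have hstep : ∀ i < N, w' (meshNode T N i) = w (meshNode T N i) →
      ∀ x ∈ Icc (0 : ℝ) 1, w' (meshNode T N i + T / N * x) = w (meshNode T N i + T / N * x) := by
    intro i hi h x hx
    obtain ⟨P, hP, hPw⟩ := hw.exists_local hT hN hp hc hi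
    obtain ⟨P', hP', hPw'⟩ := hw'.exists_local hT hN hp hc hi
    rw [h] at hP'
    rw [hPw x hx, hPw' x hx, hP'.unique hP]
  have hnode : ∀ i ≤ N, w' (meshNode T N i) = w (meshNode T N i) := by
    intro i
    induction i with
    | zero =>
      intro _
      obtain ⟨c₁, hc₁, h₁⟩ := hw.init
      obtain ⟨c₂, hc₂, h₂⟩ := hw'.init
      rw [meshNode_zero, h₁, h₂]
      exact hc₂.eqOn hT hc₁ ⟨le_rfl, hT.le⟩
    | succ i ih =>
      intro hi
      have := hstep i hi (ih (by omega)) 1 ⟨zero_le_one, le_rfl⟩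
      rwa [mul_one, ← meshNode_succ] at this
  intro t ht
  rcases ht.2.eq_or_lt with rfl | hlt
  · have := hnode N le_rfl
    rwa [meshNode_self t hN] at this
  · obtain ⟨i, hi, x, hx, rfl⟩ := exists_eq_meshNode_add hT hN ⟨ht.1, hlt⟩
    exact hstep i hi (hnode i hi.le) x ⟨hx.1, hx.2.le⟩

/-- Polynomials on the reference element with matching end point values are the pieces of a
continuous function. Clamping the local variable to `[0, 1]` makes continuity evident. -/
theorem exists_continuous_glue {T : ℝ} (hT : 0 < T) {N : ℕ} (hN : 1 ≤ N) (P : ℕ → Polynomial ℝ)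
    (hP : ∀ i, (P (i + 1)).eval 0 = (P i).eval 1) :
    ∃ w : ℝ → ℝ, Continuous w ∧ ∀ i < N, ∀ x ∈ Icc (0 : ℝ) 1,
      w (meshNode T N i + T / N * x) = (P i).eval x := by
  have hN' : (0 : ℝ) < N := by positivity
  refine ⟨fun t => (P 0).eval 0 + ∑ j ∈ Finset.range N,
    ((P j).eval (max 0 (min (N / T * t - j) 1)) - (P j).eval 0), ?_, fun i hi x hx => ?_⟩
  · refine continuous_const.add (continuous_finsetSum _ fun j _ => ?_)
    fun_prop
  have harg : ∀ j : ℕ, N / T * (meshNode T N i + T / N * x) - j = i + x - j := by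
    intro j
    simp only [meshNode]
    field_simp
  simp only [harg]
  have htel : ∀ n ≤ N, i < n → ∑ j ∈ Finset.range n,
      ((P j).eval (max 0 (min (i + x - j) 1)) - (P j).eval 0) = (P i).eval x - (P 0).eval 0 := by
    intro n hn hin
    have hlow : ∑ j ∈ Finset.range i,
        ((P j).eval (max 0 (min (i + x - j) 1)) - (P j).eval 0) =
          (P i).eval 0 - (P 0).eval 0 := by
      rw [← Finset.sum_range_sub (fun j => (P j).eval 0) i]
      refine Finset.sum_congr rfl fun j hj => ?_
      have hji : (j : ℝ) + 1 ≤ i := by exact_mod_cast Finset.mem_range.1 hj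
      rw [min_eq_right (by linarith [hx.1]), max_eq_right zero_le_one, hP]
    induction n, hin using Nat.le_induction with
    | base =>
      rw [Finset.sum_range_succ, hlow, add_sub_cancel_left, min_eq_left hx.2, max_eq_right hx.1]
      ring
    | succ n hin ih =>
      have hni : (i : ℝ) + 1 ≤ n := by exact_mod_cast hin
      rw [Finset.sum_range_succ, ih (by omega),
        max_eq_left ((min_le_left _ _).trans (by linarith [hx.2])), sub_self, add_zero]
  rw [htel N le_rfl hi]
  ring

theorem exists_isProj {T : ℝ} (hT : 0 < T) {N : ℕ} (hN : 1 ≤ N) {p : ℕ} (hp : 1 ≤ p)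
    {v c : ℝ → ℝ} (hcc : Continuous c) (hc : IsContRep T v c) : ∃ w, IsProj T N p v w := by
  have hN' : (0 : ℝ) < N := by positivity
  have hex : ∀ (i : ℕ) (a : ℝ), ∃ P, IsLocalProj (1 / N) p a
      (fun x => c (meshNode T N i + T / N * x)) P := fun i a =>
    IsLocalProj.exists _ _ _ (by fun_prop)
  choose sol hsol using hex
  let P : ℕ → Polynomial ℝ := fun i =>
    Nat.rec (sol 0 (c 0)) (fun j Q => sol (j + 1) (Q.eval 1)) i
  have hP0 : (P 0).eval 0 = c 0 := (hsol 0 (c 0)).init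
  have hPs : ∀ i, (P (i + 1)).eval 0 = (P i).eval 1 := fun i => (hsol (i + 1) _).init
  have hP : ∀ i, IsLocalProj (1 / N) p ((P i).eval 0)
      (fun x => c (meshNode T N i + T / N * x)) (P i) := by
    intro i
    cases i with
    | zero => rw [hP0]; exact hsol 0 (c 0)
    | succ j => rw [hPs]; exact hsol (j + 1) _
  obtain ⟨w, hw, hwP⟩ := exists_continuous_glue hT hN P hPs
  refine ⟨w, ⟨hw.continuousOn, fun i hi => ?_⟩, ⟨c, hc, ?_⟩, fun q hq => ?_⟩
  · refine ⟨(P i).comp (Polynomial.C (-(i : ℝ)) + Polynomial.C (N / T) * Polynomial.X),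
      (natDegree_comp_linear_le _ _ _).trans (mem_degreeLT_succ_iff.1 (hP i).mem), fun t ht => ?_⟩
    have hx : (-(i : ℝ) + N / T * t) ∈ Icc (0 : ℝ) 1 := by
      have h1 := ht.1
      have h2 := ht.2
      simp only [meshNode] at h1 h2
      push_cast at h2
      have h3 : N / T * (i * (T / N)) = (i : ℝ) := by field_simp
      have h4 : N / T * ((i + 1) * (T / N)) = (i : ℝ) + 1 := by field_simp
      have h5 : (0 : ℝ) < N / T := by positivity
      constructor <;> nlinarith [mul_lt_mul_of_pos_left h1 h5, mul_lt_mul_of_pos_left h2 h5]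
    have := hwP i hi _ hx
    simp only [Polynomial.eval_comp, Polynomial.eval_add, Polynomial.eval_mul,
      Polynomial.eval_C, Polynomial.eval_X]
    rw [← this]
    congr 1
    simp only [meshNode]
    field_simp
    ring
  · have := hwP 0 (by omega) 0 ⟨le_rfl, zero_le_one⟩
    rwa [meshNode_zero, mul_zero, add_zero, hP0] at this
  · rw [integral_mul_volT_congr hc]
    refine (orth_iff_local hT hN hp hcc.continuousOn hw.continuousOn).2 (fun i hi q hq => ?_) q hq
    rw [← (hP i).orth q hq]
    refine intervalIntegral.integral_congr fun x hx => ?_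
    rw [uIcc_of_le zero_le_one] at hx
    simp only [hwP i hi x hx]

theorem aestronglyMeasurable_volT {T : ℝ} {w : ℝ → ℝ} (hw : ContinuousOn w (Icc 0 T)) :
    AEStronglyMeasurable w (volT T) :=
  (hw.mono Ioo_subset_Icc_self).aestronglyMeasurable measurableSet_Ioo

theorem memLp_two_volT_of_continuousOn {T : ℝ} {w : ℝ → ℝ} (hw : ContinuousOn w (Icc 0 T)) :
    MemLp w 2 (volT T) := by
  obtain ⟨B, hB⟩ := isCompact_Icc.exists_bound_of_continuousOn hw
  exact MemLp.of_bound (aestronglyMeasurable_volT hw) B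
    ((ae_volT_mem T).mono fun t ht => hB t (Ioo_subset_Icc_self ht))

theorem locallyIntegrableOn_of_integrable_volT {T : ℝ} {f : ℝ → ℝ} (hf : Integrable f (volT T)) :
    LocallyIntegrableOn f (Ioo 0 T) :=
  IntegrableOn.locallyIntegrableOn hf

/-- The classical derivative, which exists off the nodes and is bounded, is the weak derivative. -/
theorem ContPoly.memH1 {T : ℝ} (hT : 0 < T) {N : ℕ} (hN : 1 ≤ N) {p : ℕ} {w : ℝ → ℝ}
    (hw : w ∈ ContPoly T N p) : MemH1 T w := by
  obtain ⟨hwc, hwp⟩ := hw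
  have hex : ∀ i, ∃ r : Polynomial ℝ, i < N →
      ∀ t ∈ Ioo (meshNode T N i) (meshNode T N (i + 1)), w t = r.eval t := by
    intro i
    by_cases hi : i < N
    · obtain ⟨r, _, hr⟩ := hwp i hi
      exact ⟨r, fun _ => hr⟩
    · exact ⟨0, fun h => absurd h hi⟩
  choose r hr using hex
  have hder : ∀ i < N, ∀ t ∈ Ioo (meshNode T N i) (meshNode T N (i + 1)),
      HasDerivAt w ((r i).derivative.eval t) t := fun i hi t ht =>
    ((r i).hasDerivAt t).congr_of_eventuallyEq
      (Filter.eventuallyEq_of_mem (Ioo_mem_nhds ht.1 ht.2) (hr i hi))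
  have hBex : ∀ i, ∃ B : ℝ, ∀ t ∈ Icc 0 T, ‖(r i).derivative.eval t‖ ≤ B := fun i =>
    isCompact_Icc.exists_bound_of_continuousOn (r i).derivative.continuousOn
  choose B hB using hBex
  have hnull : ∀ᵐ t ∂(volT T), t ∉ range (meshNode T N) :=
    ae_restrict_of_ae (measure_eq_zero_iff_ae_notMem.1 ((countable_range _).measure_zero volume))
  have hbound : ∀ᵐ t ∂(volT T), ‖deriv w t‖ ≤ ∑ i ∈ Finset.range N, B i := by
    filter_upwards [hnull, ae_volT_mem T] with t hn ht
    obtain ⟨i, hi, hti⟩ := exists_mem_element hT hN ht hn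
    rw [(hder i hi t hti).deriv]
    have hB0 : ∀ j, 0 ≤ B j := fun j => (norm_nonneg _).trans (hB j 0 ⟨le_rfl, hT.le⟩)
    exact (hB i t (Ioo_subset_Icc_self ht)).trans
      (Finset.single_le_sum (fun j _ => hB0 j) (Finset.mem_range.2 hi))
  have hg : MemLp (deriv w) 2 (volT T) :=
    MemLp.of_bound (measurable_deriv w).aestronglyMeasurable _ hbound
  have hgi := hg.integrable one_le_two
  have hw2 := memLp_two_volT_of_continuousOn hwc
  have hwi := hw2.integrable one_le_two
  refine ⟨hw2, deriv w, hg, locallyIntegrableOn_of_integrable_volT hwi,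
    locallyIntegrableOn_of_integrable_volT hgi, fun φ hφ _ hφs => ?_⟩
  have hφ1 : ContDiff ℝ 1 φ := hφ.of_le (by simp)
  have h1 := integrable_mul_volT hT.le hgi hφ.continuous
  have h2 := integrable_mul_volT hT.le hwi hφ1.continuous_deriv_one
  have hftc := integral_eq_of_hasDerivAt_off_countable_of_le (fun t => w t * φ t)
    (fun t => deriv w t * φ t + w t * deriv φ t) hT.le (countable_range (meshNode T N))
    (hwc.mul hφ.continuous.continuousOn) (fun t ht => by
      obtain ⟨i, hi, hti⟩ := exists_mem_element hT hN ht.1 ht.2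
      have := (hder i hi t hti)
      rw [← this.deriv] at this
      exact this.mul (hφ1.differentiable_one t).hasDerivAt)
    ((integrable_volT_iff hT.le).1 (h1.add h2))
  have h3 : φ 0 = 0 := image_eq_zero_of_notMem_tsupport fun h => (hφs h).1.false
  have h4 : φ T = 0 := image_eq_zero_of_notMem_tsupport fun h => (hφs h).2.false
  rw [← integral_volT hT.le, integral_add h1 h2] at hftc
  simp only [h3, h4, mul_zero, sub_zero] at hftc
  linarith

/-! ### The nodal error -/

theorem abs_le_pow_mul_of_recursion {ρ D : ℝ} (hρ : 1 ≤ ρ) (hD : 0 ≤ D) {N : ℕ} {y : ℕ → ℝ}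
    (h : ∀ i < N, |y (i + 1)| ≤ ρ * |y i| + D) :
    ∀ i ≤ N, |y i| ≤ ρ ^ i * (|y 0| + i * D) := by
  intro i
  induction i with
  | zero => intro _; simp
  | succ i ih =>
    intro hi
    have h1 : D ≤ ρ ^ (i + 1) * D := le_mul_of_one_le_left hD (one_le_pow₀ hρ)
    calc |y (i + 1)| ≤ ρ * |y i| + D := h i (by omega)
      _ ≤ ρ * (ρ ^ i * (|y 0| + i * D)) + ρ ^ (i + 1) * D := by
          gcongr
          exact ih (by omega)
      _ = ρ ^ (i + 1) * (|y 0| + (i + 1 : ℕ) * D) := by push_cast; ring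

/-- Growth over `N` steps by a factor `R` with `R² ≤ e^{1 / N}` is bounded independently of `N`. -/
theorem abs_le_two_mul_of_recursion {N : ℕ} (hN : 1 ≤ N) {R D : ℝ} (hR : R ^ 2 ≤ Real.exp (1 / N))
    (hD : 0 ≤ D) {y : ℕ → ℝ} (h : ∀ i < N, |y (i + 1)| ≤ |R| * |y i| + D) :
    ∀ i ≤ N, |y i| ≤ 2 * (|y 0| + N * D) := by
  have hN' : (0 : ℝ) < N := by positivity
  set ρ := Real.exp (1 / (2 * N)) with hρ
  have hρ1 : 1 ≤ ρ := Real.one_le_exp (by positivity)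
  have hRρ : |R| ≤ ρ := by
    refine abs_le_of_sq_le_sq (hR.trans_eq ?_) (by positivity)
    rw [hρ, ← Real.exp_nat_mul]
    congr 1
    push_cast
    field_simp
  have hρN : ρ ^ N ≤ 2 := by
    have h1 : ρ ^ N = Real.exp (1 / 2) := by
      rw [hρ, ← Real.exp_nat_mul]
      congr 1
      field_simp
    have h2 : Real.exp (1 / 2) ^ 2 = Real.exp 1 := by
      rw [← Real.exp_nat_mul]
      norm_num
    rw [h1]
    nlinarith [Real.exp_one_lt_d9, Real.exp_pos (1 / 2)]
  intro i hi
  have hiN : (i : ℝ) ≤ N := by exact_mod_cast hi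
  calc |y i| ≤ ρ ^ i * (|y 0| + i * D) := abs_le_pow_mul_of_recursion hρ1 hD (fun i hi =>
        (h i hi).trans (by gcongr)) i hi
    _ ≤ ρ ^ N * (|y 0| + N * D) := by gcongr
    _ ≤ 2 * (|y 0| + N * D) := by gcongr

/-- For nonpositive `R`, slowly varying forcing terms `κ b_i` cancel up to their increments: the
shift by the quasi-stationary solution `κ b_i / (1 - R)` removes them. -/
theorem abs_le_of_recursion_of_nonpos {N : ℕ} (hN : 1 ≤ N) {R κ B Δ D : ℝ}
    (hR : R ^ 2 ≤ Real.exp (1 / N)) (hR0 : R ≤ 0) (hΔ : 0 ≤ Δ) (hD : 0 ≤ D) {e b d : ℕ → ℝ}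
    (he0 : e 0 = 0) (he : ∀ i < N, e (i + 1) = R * e i + κ * b i + d i)
    (hb : ∀ i ≤ N, |b i| ≤ B) (hbb : ∀ i < N, |b (i + 1) - b i| ≤ Δ) (hd : ∀ i < N, |d i| ≤ D) :
    ∀ i ≤ N, |e i| ≤ 3 * (|κ| * B) + 2 * (N * (|κ| * Δ + D)) := by
  have hR1 : 0 < 1 - R := by linarith
  set κ' := κ / (1 - R) with hκ'
  have hκle : |κ'| ≤ |κ| := by
    rw [hκ', abs_div, abs_of_pos hR1]
    exact div_le_self (abs_nonneg κ) (by linarith)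
  have hκe : κ' * (1 - R) = κ := by rw [hκ']; field_simp
  have hshift : ∀ i ≤ N, |κ' * b i| ≤ |κ| * B := fun i hi => by
    rw [abs_mul]
    exact mul_le_mul hκle (hb i hi) (abs_nonneg _) (abs_nonneg _)
  have hrec := abs_le_two_mul_of_recursion hN hR (D := |κ| * Δ + D)
    (add_nonneg (mul_nonneg (abs_nonneg _) hΔ) hD) (y := fun i => e i - κ' * b i) (fun i hi => by
      have h1 : e (i + 1) - κ' * b (i + 1) =
          R * (e i - κ' * b i) + (d i - κ' * (b (i + 1) - b i)) := by
        rw [he i hi, ← hκe]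
        ring
      have h2 : |κ' * (b (i + 1) - b i)| ≤ |κ| * Δ := by
        rw [abs_mul]
        exact mul_le_mul hκle (hbb i hi) (abs_nonneg _) (abs_nonneg _)
      rw [h1]
      refine (abs_add_le _ _).trans ?_
      rw [abs_mul]
      have h3 := abs_sub (d i) (κ' * (b (i + 1) - b i))
      linarith [hd i hi])
  intro i hi
  have h1 := hrec i hi
  have h2 := hshift 0 (Nat.zero_le N)
  have h3 := hshift i hi
  simp only [he0, zero_sub, abs_neg] at h1
  have h4 : |e i| ≤ |e i - κ' * b i| + |κ' * b i| := by
    simpa using abs_add_le (e i - κ' * b i) (κ' * b i)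
  linarith

/-- The error recursion on one element. On the reference element the function is a Taylor polynomial
of degree `p`, which the projection reproduces, plus a multiple of `x^{p+1}`, plus a remainder. -/
theorem abs_error_sub_recursion_le {θ : ℝ} {p : ℕ} {K : ℝ}
    (hK : ∀ (f : ℝ → ℝ) (F : ℝ) (P : Polynomial ℝ),
      (∀ x ∈ Icc (0 : ℝ) 1, |f x| ≤ F) → IsLocalProj θ p 0 f P → |P.eval 1| ≤ K * F)
    {z k : Polynomial ℝ} (hz : IsLocalProj θ p 1 (fun _ => 0) z)
    (hk : IsLocalProj θ p 0 (fun x => x ^ (p + 1)) k) {a h M : ℝ} (hh : 0 < h) (hM : 0 ≤ M)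
    {d : ℕ → ℝ → ℝ} (hdc : ∀ j ≤ p + 1, Continuous (d j))
    (hder : ∀ j < p + 1, ∀ t ∈ Ioo a (a + h), HasDerivAt (d j) (d (j + 1) t) t)
    (hlip : ∀ t ∈ Icc a (a + h), |d (p + 1) t - d (p + 1) a| ≤ M * (t - a))
    {y : ℝ} {P : Polynomial ℝ} (hP : IsLocalProj θ p y (fun x => d 0 (a + h * x)) P) :
    |d 0 (a + h) - P.eval 1 - (z.eval 1 * (d 0 a - y) +
      h ^ (p + 1) * (1 - k.eval 1) / (p + 1).factorial * d (p + 1) a)| ≤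
      (1 + K) * (M * h ^ (p + 2)) := by
  set A : Polynomial ℝ := ∑ j ∈ Finset.range (p + 1),
    Polynomial.C (d j a / j.factorial * h ^ j) * Polynomial.X ^ j with hA
  set m : ℝ := d (p + 1) a / (p + 1).factorial * h ^ (p + 1) with hm
  have hAeval : ∀ x : ℝ, A.eval x =
      ∑ j ∈ Finset.range (p + 1), d j a / j.factorial * (h * x) ^ j := by
    intro x
    rw [hA, Polynomial.eval_finsetSum]
    refine Finset.sum_congr rfl fun j _ => ?_
    simp only [Polynomial.eval_mul, Polynomial.eval_C, Polynomial.eval_pow, Polynomial.eval_X]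
    ring
  have hAmem : A ∈ Polynomial.degreeLT ℝ (p + 1) := by
    refine Submodule.sum_mem _ fun j hj => ?_
    rw [Polynomial.mem_degreeLT]
    exact (Polynomial.degree_C_mul_X_pow_le _ _).trans_lt
      (by exact_mod_cast Finset.mem_range.1 hj)
  have hA0 : A.eval 0 = d 0 a := by
    rw [hAeval, Finset.sum_range_succ']
    simp
  set r : ℝ → ℝ := fun x => d 0 (a + h * x) - (A.eval x + m * x ^ (p + 1)) with hr
  have hd0 := hdc 0 (by omega)
  have hrc : Continuous r := by fun_prop
  have hrb : ∀ x ∈ Icc (0 : ℝ) 1, |r x| ≤ M * h ^ (p + 2) := by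
    intro x hx
    have ht : a + h * x ∈ Icc a (a + h) := by constructor <;> nlinarith [hx.1, hx.2]
    have h1 := abs_sub_taylor_le hM (p + 1) d hdc hder hlip _ ht
    rw [add_sub_cancel_left, Finset.sum_range_succ, ← hAeval, mul_pow h x (p + 1),
      ← mul_assoc, ← hm] at h1
    refine h1.trans ?_
    have h2 : 0 ≤ h * x := mul_nonneg hh.le hx.1
    have h3 : h * x ≤ h := mul_le_of_le_one_right hh.le hx.2
    gcongr
  obtain ⟨s, hs⟩ := IsLocalProj.exists θ p 0 hrc.continuousOn
  have hsb := hK r _ s hrb hs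
  have hcomb := (((IsLocalProj.self (θ := θ) hAmem).add A.continuousOn (by fun_prop)
    (hk.smul m)).add (by fun_prop) hrc.continuousOn hs).add (by fun_prop) (by fun_prop)
      (hz.smul (-(d 0 a - y)))
  have hcongr : (fun x => A.eval x + m * x ^ (p + 1) + r x + -(d 0 a - y) * 0) =
      fun x => d 0 (a + h * x) := by
    funext x
    simp only [hr]
    ring
  have hinit : A.eval 0 + m * 0 + 0 + -(d 0 a - y) * 1 = y := by
    rw [hA0]
    ring
  rw [hcongr, hinit] at hcomb
  have hPeq := hP.unique hcomb
  have hr1 := hrb 1 ⟨zero_le_one, le_rfl⟩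
  have hid : d 0 (a + h) - P.eval 1 - (z.eval 1 * (d 0 a - y) +
      h ^ (p + 1) * (1 - k.eval 1) / (p + 1).factorial * d (p + 1) a) = r 1 - s.eval 1 := by
    rw [hPeq]
    simp only [hr, hm, Polynomial.eval_add, Polynomial.eval_mul, Polynomial.eval_C, mul_one,
      one_pow]
    ring
  rw [hid]
  refine (abs_sub _ _).trans ?_
  linarith

/-- The nodal error estimate. For even `p` the errors of the elements add up; for odd `p` the
amplification factor is negative and their leading parts cancel. -/
theorem exists_nodal_error_bound (p : ℕ) (hp : 1 ≤ p) (T : ℝ) (hT : 0 < T) :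
    ∃ C : ℝ, 0 < C ∧
      ∀ N : ℕ, 1 ≤ N → ∀ v : ℝ → ℝ, MemWInfTilde T (p + 2) v →
        ∀ c : ℝ → ℝ, IsContRep T v c → ∀ w : ℝ → ℝ, IsProj T N p v w →
          ∀ i : ℕ, i ≤ N →
            |c (meshNode T N i) - w (meshNode T N i)| ≤
              C * (T / N) ^ (p + p % 2) *
                (normLInf T (iteratedDeriv (p + 1) c) +
                  normLInf T (iteratedDeriv (p + 2) c)) := by
  obtain ⟨K, hK0, hK⟩ := exists_abs_eval_one_le p
  refine ⟨4 * (1 + K) * (1 + T) ^ 2, by positivity, fun N hN v hv c hc w hw => ?_⟩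
  have hN' : (0 : ℝ) < N := by positivity
  have hθ0 : (0 : ℝ) ≤ 1 / N := by positivity
  have hθ1 : (1 : ℝ) / N ≤ 1 := by
    rw [div_le_one hN']
    exact_mod_cast hN
  set h := T / N with hh
  have hh0 : 0 < h := by positivity
  have hNh : N * h = T := by rw [hh]; field_simp
  have hhT : h ≤ T := by
    rw [hh, div_eq_mul_one_div]
    exact mul_le_of_le_one_right hT.le hθ1
  set M₁ := normLInf T (iteratedDeriv (p + 1) c)
  set M₂ := normLInf T (iteratedDeriv (p + 2) c)
  have hM₁ : 0 ≤ M₁ := ENNReal.toReal_nonneg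
  have hM₂ : 0 ≤ M₂ := ENNReal.toReal_nonneg
  obtain ⟨d, hdc, h0, hder, hbd, hlip⟩ := hv.exists_derivatives hT hc
  obtain ⟨z, hz⟩ := IsLocalProj.exists (1 / N) p 1 (f := fun _ => 0) continuousOn_const
  obtain ⟨k, hk⟩ := IsLocalProj.exists (1 / N) p 0 (f := fun x => x ^ (p + 1)) (by fun_prop)
  have hk1 : |k.eval 1| ≤ K * 1 := hK _ hθ0 hθ1 _ 1 k (fun x hx => by
    rw [abs_pow, abs_of_nonneg hx.1]
    exact pow_le_one₀ hx.1 hx.2) hk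
  set R := z.eval 1
  have hR : R ^ 2 ≤ Real.exp (1 / N) := hz.eval_one_sq_le hθ0
  set κ := h ^ (p + 1) * (1 - k.eval 1) / (p + 1).factorial with hκ
  have hκle : |κ| ≤ (1 + K) * h ^ (p + 1) := by
    have h1 : |1 - k.eval 1| ≤ 1 + K := by
      refine (abs_sub _ _).trans ?_
      rw [abs_one]
      linarith
    have h2 : (1 : ℝ) ≤ (p + 1).factorial := by exact_mod_cast Nat.succ_le_of_lt (Nat.factorial_pos _)
    rw [hκ, abs_div, abs_mul, abs_of_pos (pow_pos hh0 _), abs_of_pos (by positivity :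
      (0 : ℝ) < (p + 1).factorial)]
    calc h ^ (p + 1) * |1 - k.eval 1| / (p + 1).factorial ≤ h ^ (p + 1) * |1 - k.eval 1| :=
          div_le_self (by positivity) h2
      _ ≤ h ^ (p + 1) * (1 + K) := by gcongr
      _ = _ := mul_comm _ _
  set e : ℕ → ℝ := fun i => c (meshNode T N i) - w (meshNode T N i) with he
  set b : ℕ → ℝ := fun i => d (p + 1) (meshNode T N i)
  have he0 : e 0 = 0 := by
    obtain ⟨c', hc', hw0⟩ := hw.init
    simp only [he, meshNode_zero, hw0]
    exact sub_eq_zero.2 (hc.eqOn hT hc' ⟨le_rfl, hT.le⟩)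
  have hb : ∀ i ≤ N, |b i| ≤ M₁ := fun i hi => hbd _ (meshNode_mem_Icc hT hN hi)
  have hbb : ∀ i < N, |b (i + 1) - b i| ≤ M₂ * h := fun i hi => by
    have := hlip _ (meshNode_mem_Icc hT hN hi.le) _ (meshNode_mem_Icc hT hN hi)
      (meshNode_mono hT N (Nat.le_succ i))
    rwa [meshNode_succ T N i, add_sub_cancel_left, ← meshNode_succ] at this
  have hstep : ∀ i < N, |e (i + 1) - (R * e i + κ * b i)| ≤ (1 + K) * (M₂ * h ^ (p + 2)) := by
    intro i hi
    obtain ⟨P, hP, hwP⟩ := hw.exists_local hT hN hp hc hi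
    have hsub := element_subset hT hi
    rw [meshNode_succ, ← hh] at hsub
    have hIoo : Ioo (meshNode T N i) (meshNode T N i + h) ⊆ Ioo 0 T :=
      Ioo_subset_Ioo (meshNode_mem_Icc hT hN hi.le).1
        (by rw [hh, ← meshNode_succ]; exact (meshNode_mem_Icc hT hN hi).2)
    have hc0 : ∀ x ∈ Icc (0 : ℝ) 1, c (meshNode T N i + h * x) = d 0 (meshNode T N i + h * x) :=
      fun x hx => h0 (element_subset hT hi (meshNode_add_mul_mem_Icc hT hx))
    have hP' := hP.congr (g := fun x => d 0 (meshNode T N i + h * x)) hc0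
    have := abs_error_sub_recursion_le (hK _ hθ0 hθ1) hz hk hh0 hM₂ hdc
      (fun j hj t ht => hder j hj t (hIoo ht))
      (fun t ht => hlip _ (meshNode_mem_Icc hT hN hi.le) t (hsub ht) ht.1) hP'
    have h1 := hc0 1 ⟨zero_le_one, le_rfl⟩
    have h2 := hwP 1 ⟨zero_le_one, le_rfl⟩
    have h3 := hc0 0 ⟨le_rfl, zero_le_one⟩
    rw [mul_one] at h1 h2
    rw [mul_zero, add_zero] at h3
    rw [← h1, ← h2, ← h3] at this
    simp only [he, b, meshNode_succ]
    exact this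
  rcases Nat.even_or_odd p with hpar | hpar
  · intro i hi
    have hrec := abs_le_two_mul_of_recursion hN hR
      (D := (1 + K) * h ^ (p + 1) * M₁ + (1 + K) * (M₂ * h ^ (p + 2))) (by positivity) (y := e)
      (fun i hi => by
        have h1 := hstep i hi
        have h2 : |κ * b i| ≤ (1 + K) * h ^ (p + 1) * M₁ := by
          rw [abs_mul]
          exact mul_le_mul hκle (hb i hi.le) (abs_nonneg _) (by positivity)
        have h3 : |e (i + 1)| ≤ |e (i + 1) - (R * e i + κ * b i)| + (|R * e i| + |κ * b i|) := by
          have h4 := abs_add_le (e (i + 1) - (R * e i + κ * b i)) (R * e i + κ * b i)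
          rw [sub_add_cancel] at h4
          linarith [abs_add_le (R * e i) (κ * b i)]
        rw [abs_mul R] at h3
        linarith) i hi
    rw [he0, abs_zero, zero_add] at hrec
    rw [Nat.even_iff.1 hpar, add_zero]
    calc |e i| ≤ _ := hrec
      _ = (1 + K) * h ^ p * (2 * (N * h) * (M₁ + h * M₂)) := by ring
      _ ≤ (1 + K) * h ^ p * (4 * (1 + T) ^ 2 * (M₁ + M₂)) := by
          rw [hNh]
          refine mul_le_mul_of_nonneg_left ?_ (by positivity)
          nlinarith [mul_le_mul_of_nonneg_right hhT (mul_nonneg hT.le hM₂),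
            mul_nonneg hT.le hM₁, mul_nonneg hT.le hM₂, mul_nonneg (sq_nonneg T) hM₁,
            mul_nonneg (sq_nonneg T) hM₂]
      _ = _ := by ring
  · intro i hi
    have hrec := abs_le_of_recursion_of_nonpos (κ := κ) hN hR (hz.eval_one_neg hpar).le
      (by positivity) (by positivity) he0
      (d := fun i => e (i + 1) - (R * e i + κ * b i)) (fun i _ => by ring) hb hbb hstep i hi
    rw [Nat.odd_iff.1 hpar]
    calc |e i| ≤ _ := hrec
      _ ≤ 3 * ((1 + K) * h ^ (p + 1) * M₁) +
          2 * (N * ((1 + K) * h ^ (p + 1) * (M₂ * h) + (1 + K) * (M₂ * h ^ (p + 2)))) := by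
          gcongr
      _ = (1 + K) * h ^ (p + 1) * (3 * M₁ + 4 * (N * h) * M₂) := by ring
      _ ≤ (1 + K) * h ^ (p + 1) * (4 * (1 + T) ^ 2 * (M₁ + M₂)) := by
          rw [hNh]
          refine mul_le_mul_of_nonneg_left ?_ (by positivity)
          nlinarith [mul_nonneg hT.le hM₁, mul_nonneg hT.le hM₂, mul_nonneg (sq_nonneg T) hM₁,
            mul_nonneg (sq_nonneg T) hM₂]
      _ = _ := by ring

theorem proposition3p15 (p : ℕ) (hp : 1 ≤ p) (T : ℝ) (hT : 0 < T) :
    (∀ N : ℕ, 1 ≤ N →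
      (∀ v : ℝ → ℝ, MemH1 T v →
        ∃ w : ℝ → ℝ, IsProj T N p v w ∧
          ∀ w' : ℝ → ℝ, IsProj T N p v w' → EqOn w' w (Icc 0 T)) ∧
      (∀ w ∈ ContPoly T N p, MemH1 T w ∧ IsProj T N p w w)) ∧
    ∃ C : ℝ, 0 < C ∧
      ∀ N : ℕ, 1 ≤ N → ∀ v : ℝ → ℝ, MemWInfTilde T (p + 2) v →
        ∀ c : ℝ → ℝ, IsContRep T v c → ∀ w : ℝ → ℝ, IsProj T N p v w →
          ∀ i : ℕ, 1 ≤ i → i ≤ N →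
            |c (meshNode T N i) - w (meshNode T N i)| ≤
              C * (T / N) ^ (p + p % 2) *
                (normLInf T (iteratedDeriv (p + 1) c) +
                  normLInf T (iteratedDeriv (p + 2) c)) := by
  refine ⟨fun N hN => ⟨fun v hv => ?_, fun w hw => ⟨ContPoly.memH1 hT hN hw, hw,
    ⟨w, ⟨hw.1, Filter.EventuallyEq.rfl⟩, rfl⟩, fun _ _ => rfl⟩⟩, ?_⟩
  · obtain ⟨c, hcc, hc⟩ := hv.exists_isContRep hT
    obtain ⟨w, hw⟩ := exists_isProj hT hN hp hcc hc
    exact ⟨w, hw, fun w' hw' => hw.unique hT hN hp hc hw'⟩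
  · obtain ⟨C, hC, hbound⟩ := exists_nodal_error_bound p hp T hT
    exact ⟨C, hC, fun N hN v hv c hc w hw i _ hi => hbound N hN v hv c hc w hw i hi⟩
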